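/- Let $q,a\in\mathbb{C}^\times$ with $q$ not a root of unity. Let $(V(b))_{b\in\mathbb{C}^\times}$ and $(W(b))_{b\in\mathbb{C}^\times}$ be families of complex vector spaces such that $\bigoplus_b V(b)$ and $\bigoplus_b W(b)$ are finite-dimensional, and such that $V(qb)=0=W(b)$ whenever $b\notin\{q^{2k}a : k\in\mathbb{Z}\}$. Put $$\mathbf{M}^\bullet=\bigoplus_{b}\mathrm{Hom}(W(b),V(qb))\oplus\bigoplus_{b}\mathrm{Hom}(V(b),W(qb)),$$ with elements $(\alpha,\beta)=((\alpha_b)_b,(\beta_b)_b)$, with the action of $G_V=\prod_b \mathrm{GL}(V(b))$ given by $g\cdot(\alpha,\beta)=((g_{qb}\alpha_b)_b,(\beta_b g_b^{-1})_b)$, and let $\mu^{-1}(0)\subseteq\mathbf{M}^\bullet$ be the closed subvariety defined by $\alpha_{qb}\beta_b=0$ for all $b$. Let $\mu^{-1}(0)^s\subseteq\mu^{-1}(0)$ be the open subset of stable points, i.e. those with all $\beta_b$ injective. Let $\mathfrak{M}^\bullet(V,W)=\mu^{-1}(0)^s/G_V$ be the (possibly empty) geometric quotient, that is, the set of orbits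 with the quotient topology, where a function is regular if and only if its pullback to $\mu^{-1}(0)^s$ is regular. Let $\mathfrak{M}_0^\bullet(V,W)=\mu^{-1}(0)/\!/G_V$ be the spectrum of the ring of $G_V$-invariant regular functions on $\mu^{-1}(0)$. Let $\pi:\mathfrak{M}^\bullet(V,W)\to\mathfrak{M}_0^\bullet(V,W)$ be the natural morphism: it maps the orbit of $x$ to the point "evaluation of invariants at $x$", i.e. to the point given by the closed orbit in the closure of the orbit of $x$. Varieties over $\mathbb{C}$ are understood classically, as spaces with sheaves of regular functions, and subvarieties carry the reduced structure. Then there are isomorphisms of varieties $\Phi$ and $\Psi$ as follows. 1. $\Phi$ is an isomorphism from $\mathfrak{M}^\bullet(V,W)$ onto the subvariety of $$\bigoplus_{k\in\mathbb{Z}}\mathrm{Hom}(W(q^{2k}a),W(q^{2(k+1)}a))\times\prod_{k\in\mathbb{Z}}\mathrm{Gr}_{\dim V(q^{2k-1}a)}(W(q^{2k}a))$$ of all tuples $((f_k)_k,(U(q^{2k}a)\subseteq W(q^{2k}a))_k)$ such that $f_k(W(q^{2k}a))\subseteq U(q^{2(k+1)}a)$ and $f_k(U(q^{2k}a))=0$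 for all $k\in\mathbb{Z}$. Here $\mathrm{Gr}_d(E)$ is the Grassmannian of $d$-dimensional subspaces of $E$. 2. $\Psi$ is an isomorphism from $\mathfrak{M}^\bullet_0(V,W)$ onto the affine variety $$\Big\{(f_k)_{k}\in\bigoplus_{k\in\mathbb{Z}}\mathrm{Hom}(W(q^{2k}a),W(q^{2(k+1)}a)) : f_{k+1}f_k=0,\ \mathrm{rk}(f_k)\le\dim V(q^{2k+1}a)\ \text{ for all } k\in\mathbb{Z}\Big\}.$$ 3. Under these isomorphisms $\pi$ is the map forgetting the subspaces: if $\Phi(p)=((f_k)_k,(U(q^{2k}a))_k)$, then $\Psi(\pi(p))=(f_k)_k$. -/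

import Mathlib

open Topology DirectSum

noncomputable section

namespace RankOneQuiver

universe u v w

/-! ## Complex algebraic varieties as spaces with functions

A variety over `ℂ` is regarded, classically, as a topological space (with its Zariski topology)
together with a sheaf of `ℂ`-valued functions. The sheaf is recorded by its germs: `RegularAt φ x`
says that `φ` is regular in some open neighbourhood of `x`. A function is regular on an open set
`U` if and only if it is regular at each point of `U`; its values off `U` are irrelevant by `congr`,
and the sheaf axioms are automatic. -/

/-- A space with functions: a topological space with a sheaf of algebras of `ℂ`-valued functions, in
which the nonvanishing locus of a regular function is open and its inverse is regular there. -/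
structure SpaceWithFunctions where
  carrier : Type u
  [top : TopologicalSpace carrier]
  RegularAt : (carrier → ℂ) → carrier → Prop
  congr : ∀ {φ ψ : carrier → ℂ} {x : carrier},
    (∀ᶠ y in 𝓝 x, φ y = ψ y) → RegularAt φ x → RegularAt ψ x
  eventually : ∀ {φ : carrier → ℂ} {x : carrier}, RegularAt φ x → ∀ᶠ y in 𝓝 x, RegularAt φ y
  const : ∀ (c : ℂ) (x : carrier), RegularAt (fun _ => c) x
  add : ∀ {φ ψ : carrier → ℂ} {x : carrier},
    RegularAt φ x → RegularAt ψ x → RegularAt (fun y => φ y + ψ y) x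
  mul : ∀ {φ ψ : carrier → ℂ} {x : carrier},
    RegularAt φ x → RegularAt ψ x → RegularAt (fun y => φ y * ψ y) x
  ne_zero : ∀ {φ : carrier → ℂ} {x : carrier},
    RegularAt φ x → φ x ≠ 0 → ∀ᶠ y in 𝓝 x, φ y ≠ 0
  inv : ∀ {φ : carrier → ℂ} {x : carrier},
    RegularAt φ x → φ x ≠ 0 → RegularAt (fun y => (φ y)⁻¹) x

attribute [instance] SpaceWithFunctions.top

instance : CoeSort SpaceWithFunctions.{u} (Type u) := ⟨SpaceWithFunctions.carrier⟩

/-- A morphism: a continuous map that pulls regular functions back to regular functions. -/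
def IsMorphism (X : SpaceWithFunctions.{u}) (Y : SpaceWithFunctions.{v}) (F : X → Y) : Prop :=
  Continuous F ∧ ∀ (φ : Y → ℂ) (x : X), Y.RegularAt φ (F x) → X.RegularAt (fun z => φ (F z)) x

/-- An isomorphism: a bijection that is a morphism in both directions. -/
structure Iso (X : SpaceWithFunctions.{u}) (Y : SpaceWithFunctions.{v}) where
  toEquiv : X ≃ Y
  isMorphism_toFun : IsMorphism X Y toEquiv
  isMorphism_invFun : IsMorphism Y X toEquiv.symm

/-- The Zariski topology of a set `X` with respect to an algebra `A` of functions: the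
nonvanishing loci of the functions in `A` are a basis of the open sets. -/
abbrev zariskiTopology {X : Type u} (A : Subalgebra ℂ (X → ℂ)) : TopologicalSpace X :=
  TopologicalSpace.generateFrom {U | ∃ h ∈ A, U = {x | h x ≠ 0}}

lemma zariski_eventually {X : Type u} (A : Subalgebra ℂ (X → ℂ)) {h : X → ℂ} (hh : h ∈ A) {x : X}
    (hx : h x ≠ 0) : ∀ᶠ y in @nhds X (zariskiTopology A) x, h y ≠ 0 := by
  let _ := zariskiTopology A
  have ho : IsOpen {x | h x ≠ 0} := TopologicalSpace.isOpen_generateFrom_of_mem ⟨h, hh, rfl⟩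
  exact ho.mem_nhds hx

/-- A set `X` with an algebra `A` of functions on it: Zariski topology, and regular functions are
those that are locally quotients of functions in `A`. -/
def ofAlgebra {X : Type u} (A : Subalgebra ℂ (X → ℂ)) : SpaceWithFunctions.{u} :=
  letI := zariskiTopology A
  { carrier := X
    RegularAt := fun φ x => ∃ g ∈ A, ∃ h ∈ A, h x ≠ 0 ∧ ∀ᶠ y in 𝓝 x, φ y = g y / h y
    congr := by
      rintro φ ψ x hφψ ⟨g, hg, h, hh, hx, he⟩
      refine ⟨g, hg, h, hh, hx, ?_⟩
      filter_upwards [hφψ, he] with y h1 h2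
      rw [← h1, h2]
    eventually := by
      rintro φ x ⟨g, hg, h, hh, hx, he⟩
      filter_upwards [zariski_eventually A hh hx, he.eventually_nhds] with y h1 h2
      exact ⟨g, hg, h, hh, h1, h2⟩
    const := fun c x => ⟨fun _ => c, A.algebraMap_mem c, 1, A.one_mem, by simp, by simp⟩
    add := by
      rintro φ ψ x ⟨g, hg, h, hh, hx, he⟩ ⟨g', hg', h', hh', hx', he'⟩
      refine ⟨g * h' + h * g', A.add_mem (A.mul_mem hg hh') (A.mul_mem hh hg'), h * h',
        A.mul_mem hh hh', mul_ne_zero hx hx', ?_⟩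
      filter_upwards [zariski_eventually A hh hx, zariski_eventually A hh' hx', he, he']
        with y h1 h2 h3 h4
      simp only [h3, h4, Pi.add_apply, Pi.mul_apply]
      rw [div_add_div _ _ h1 h2]
    mul := by
      rintro φ ψ x ⟨g, hg, h, hh, hx, he⟩ ⟨g', hg', h', hh', hx', he'⟩
      refine ⟨g * g', A.mul_mem hg hg', h * h', A.mul_mem hh hh', mul_ne_zero hx hx', ?_⟩
      filter_upwards [he, he'] with y h3 h4
      simp only [h3, h4, Pi.mul_apply]
      rw [div_mul_div_comm]
    ne_zero := by
      rintro φ x ⟨g, hg, h, hh, hx, he⟩ hφ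
      have hgx : g x ≠ 0 := by
        intro h0
        apply hφ
        rw [he.self_of_nhds, h0, zero_div]
      filter_upwards [zariski_eventually A hh hx, zariski_eventually A hg hgx, he] with y h1 h2 h3
      rw [h3]
      exact div_ne_zero h2 h1
    inv := by
      rintro φ x ⟨g, hg, h, hh, hx, he⟩ hφ
      have hgx : g x ≠ 0 := by
        intro h0
        apply hφ
        rw [he.self_of_nhds, h0, zero_div]
      refine ⟨h, hh, g, hg, hgx, ?_⟩
      filter_upwards [he] with y h3
      rw [h3, inv_div] }

/-- A subset `S` of `Y` as a (reduced) subvariety: subspace topology, and regular functions are those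
that locally extend to regular functions of `Y`. -/
def subspace (Y : SpaceWithFunctions.{u}) (S : Set Y) : SpaceWithFunctions.{u} where
  carrier := S
  RegularAt := fun φ x => ∃ ψ : Y → ℂ, Y.RegularAt ψ x.1 ∧ ∀ᶠ y in 𝓝 x, φ y = ψ y.1
  congr := by
    rintro φ φ' x h ⟨ψ, hψ, he⟩
    refine ⟨ψ, hψ, ?_⟩
    filter_upwards [h, he] with y h1 h2
    rw [← h1, h2]
  eventually := by
    rintro φ x ⟨ψ, hψ, he⟩
    have h1 := continuousAt_subtype_val.eventually (Y.eventually hψ)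
    filter_upwards [h1, he.eventually_nhds] with y h2 h3
    exact ⟨ψ, h2, h3⟩
  const := fun c x => ⟨fun _ => c, Y.const c _, by simp⟩
  add := by
    rintro φ φ' x ⟨ψ, hψ, he⟩ ⟨ψ', hψ', he'⟩
    refine ⟨_, Y.add hψ hψ', ?_⟩
    filter_upwards [he, he'] with y h1 h2
    rw [h1, h2]
  mul := by
    rintro φ φ' x ⟨ψ, hψ, he⟩ ⟨ψ', hψ', he'⟩
    refine ⟨_, Y.mul hψ hψ', ?_⟩
    filter_upwards [he, he'] with y h1 h2
    rw [h1, h2]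
  ne_zero := by
    rintro φ x ⟨ψ, hψ, he⟩ hφ
    rw [he.self_of_nhds] at hφ
    filter_upwards [continuousAt_subtype_val.eventually (Y.ne_zero hψ hφ), he] with y h1 h2
    rw [h2]
    exact h1
  inv := by
    rintro φ x ⟨ψ, hψ, he⟩ hφ
    rw [he.self_of_nhds] at hφ
    refine ⟨_, Y.inv hψ hφ, ?_⟩
    filter_upwards [he] with y h1
    rw [h1]

/-- The topology on `Y` that is final with respect to a family of maps `c i : X i → Y`. -/
abbrev finalTopology {ι : Type w} (X : ι → SpaceWithFunctions.{u}) {Y : Type v}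
    (c : ∀ i, X i → Y) : TopologicalSpace Y :=
  ⨆ i, TopologicalSpace.coinduced (c i) (X i).top

lemma continuous_final {ι : Type w} (X : ι → SpaceWithFunctions.{u}) {Y : Type v}
    (c : ∀ i, X i → Y) (i : ι) : @Continuous _ _ _ (finalTopology X c) (c i) := by
  let _ := finalTopology X c
  exact continuous_iff_coinduced_le.2
    (le_iSup (fun i => TopologicalSpace.coinduced (c i) (X i).top) i)

/-- The final structure on `Y` with respect to maps `c i : X i → Y`: a set is open if and only if
all its preimages are open, and a function on an open set is regular if and only if all its
pullbacks are regular. For one surjective map this is the quotient of a variety by an equivalence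
relation; for a family of compatible charts it is the glued variety. -/
def final {ι : Type w} (X : ι → SpaceWithFunctions.{u}) {Y : Type v} (c : ∀ i, X i → Y) :
    SpaceWithFunctions.{v} :=
  letI := finalTopology X c
  { carrier := Y
    RegularAt := fun φ y =>
      ∀ᶠ z in 𝓝 y, ∀ i, ∀ x : X i, c i x = z → (X i).RegularAt (fun t => φ (c i t)) x
    congr := by
      intro φ ψ y h h1
      filter_upwards [h.eventually_nhds, h1] with z h2 h3 i x hx
      subst hx
      exact (X i).congr ((continuous_final X c i).continuousAt.eventually h2) (h3 i x rfl)
    eventually := fun h => h.eventually_nhds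
    const := fun a y => Filter.Eventually.of_forall fun z i x _ => (X i).const a x
    add := by
      intro φ ψ y h h'
      filter_upwards [h, h'] with z h1 h2 i x hx
      exact (X i).add (h1 i x hx) (h2 i x hx)
    mul := by
      intro φ ψ y h h'
      filter_upwards [h, h'] with z h1 h2 i x hx
      exact (X i).mul (h1 i x hx) (h2 i x hx)
    ne_zero := by
      intro φ y h hy
      obtain ⟨U, hU, hUo, hyU⟩ := eventually_nhds_iff.1 h
      refine eventually_nhds_iff.2 ⟨{z | z ∈ U ∧ φ z ≠ 0}, fun z hz => hz.2, ?_, hyU, hy⟩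
      refine isOpen_iSup_iff.2 fun i => isOpen_coinduced.2 (isOpen_iff_mem_nhds.2 ?_)
      rintro x ⟨hxU, hx⟩
      have hx' : φ (c i x) ≠ 0 := hx
      filter_upwards [(hUo.preimage (continuous_final X c i)).mem_nhds hxU,
        (X i).ne_zero (hU _ hxU i x rfl) hx'] with t h1 h2
      exact ⟨h1, h2⟩
    inv := by
      intro φ y h hy
      have hne : ∀ᶠ z in 𝓝 y, φ z ≠ 0 := by
        obtain ⟨U, hU, hUo, hyU⟩ := eventually_nhds_iff.1 h
        refine eventually_nhds_iff.2 ⟨{z | z ∈ U ∧ φ z ≠ 0}, fun z hz => hz.2, ?_, hyU, hy⟩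
        refine isOpen_iSup_iff.2 fun i => isOpen_coinduced.2 (isOpen_iff_mem_nhds.2 ?_)
        rintro x ⟨hxU, hx⟩
        have hx' : φ (c i x) ≠ 0 := hx
        filter_upwards [(hUo.preimage (continuous_final X c i)).mem_nhds hxU,
          (X i).ne_zero (hU _ hxU i x rfl) hx'] with t h1 h2
        exact ⟨h1, h2⟩
      filter_upwards [h, hne] with z h1 h2 i x hx
      refine (X i).inv (h1 i x hx) ?_
      rw [hx]
      exact h2 }

/-- Polynomial functions on a vector space: the algebra generated by the linear functionals. -/
def polyFun (E : Type u) [AddCommGroup E] [Module ℂ E] : Subalgebra ℂ (E → ℂ) :=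
  Algebra.adjoin ℂ (Set.range fun l : Module.Dual ℂ E => (l : E → ℂ))

/-- A (finite-dimensional) complex vector space as an affine variety. -/
def affineSpace (E : Type u) [AddCommGroup E] [Module ℂ E] : SpaceWithFunctions.{u} :=
  ofAlgebra (polyFun E)

/-- The affine variety `Spec A` of a `ℂ`-algebra `A` (of finite type and reduced): its closed points
are the algebra homomorphisms `A → ℂ`, and `A` acts on them by evaluation. -/
def specm (A : Type u) [CommRing A] [Algebra ℂ A] : SpaceWithFunctions.{u} :=
  ofAlgebra (X := A →ₐ[ℂ] ℂ) (AlgHom.pi fun χ : A →ₐ[ℂ] ℂ => χ).range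

/-! ## Graded quiver varieties of type `A₁` -/

section Quiver

variable (q : ℂˣ) (V : ℂˣ → Type u) (W : ℂˣ → Type v)
  [∀ b, AddCommGroup (V b)] [∀ b, Module ℂ (V b)]
  [∀ b, AddCommGroup (W b)] [∀ b, Module ℂ (W b)]

/-- The space of pairs `(α, β)` with `α b : W b → V (q b)` and `β b : V b → W (q b)`. When only
finitely many `V b` and `W b` are nonzero, this product over `b` is the direct sum. -/
def RepSpace : Type (max u v) :=
  (∀ b, W b →ₗ[ℂ] V (q * b)) × (∀ b, V b →ₗ[ℂ] W (q * b))

instance : AddCommGroup (RepSpace q V W) :=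
  inferInstanceAs (AddCommGroup ((∀ b, W b →ₗ[ℂ] V (q * b)) × (∀ b, V b →ₗ[ℂ] W (q * b))))

instance : Module ℂ (RepSpace q V W) :=
  inferInstanceAs (Module ℂ ((∀ b, W b →ₗ[ℂ] V (q * b)) × (∀ b, V b →ₗ[ℂ] W (q * b))))

variable {q V W} in
/-- The component `α`. -/
def RepSpace.α (x : RepSpace q V W) (b : ℂˣ) : W b →ₗ[ℂ] V (q * b) := x.1 b

variable {q V W} in
/-- The component `β`. -/
def RepSpace.β (x : RepSpace q V W) (b : ℂˣ) : V b →ₗ[ℂ] W (q * b) := x.2 b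

/-- The group `G_V`, the product of the general linear groups of the `V b`. -/
abbrev GaugeGroup : Type u := ∀ b, V b ≃ₗ[ℂ] V b

/-- The action `g · (α, β) = (g_{qb} α_b, β_b g_b⁻¹)_b`. -/
instance : MulAction (GaugeGroup V) (RepSpace q V W) where
  smul g x := (fun b => (g (q * b)).toLinearMap ∘ₗ x.α b, fun b => x.β b ∘ₗ (g b)⁻¹.toLinearMap)
  one_smul _ := rfl
  mul_smul _ _ _ := rfl

/-- The fibre `μ⁻¹(0)` of the map `μ (α, β) = (α_{qb} β_b)_b`. -/
def zeroFibre : Set (RepSpace q V W) := {x | ∀ b, x.α (q * b) ∘ₗ x.β b = 0}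

/-- The stable points of `μ⁻¹(0)`: all `β b` are injective. -/
def stableLocus : Set (RepSpace q V W) :=
  {x | x ∈ zeroFibre q V W ∧ ∀ b, Function.Injective (x.β b)}

/-- Two stable points are equivalent if they lie in the same `G_V`-orbit. -/
def stableSetoid : Setoid (stableLocus q V W) :=
  (MulAction.orbitRel (GaugeGroup V) (RepSpace q V W)).comap Subtype.val

/-- The quiver variety `𝔐(V, W) = μ⁻¹(0)ˢ / G_V`: the set of orbits, with the quotient topology, a
function being regular if and only if its pullback to the stable locus is regular. -/
def quiverVariety : SpaceWithFunctions.{max u v} :=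
  final (ι := Unit) (fun _ => subspace (affineSpace (RepSpace q V W)) (stableLocus q V W))
    (Y := Quotient (stableSetoid q V W)) fun _ x => Quotient.mk (stableSetoid q V W) x

/-- The ring of `G_V`-invariant regular (that is, polynomial) functions on `μ⁻¹(0)`. -/
def invariantRing : Subalgebra ℂ (zeroFibre q V W → ℂ) where
  carrier := {F | (∃ P ∈ polyFun (RepSpace q V W), ∀ x, F x = P x.1) ∧
    ∀ (g : GaugeGroup V) (x y : zeroFibre q V W), y.1 = g • x.1 → F y = F x}
  algebraMap_mem' c := ⟨⟨_, (polyFun _).algebraMap_mem c, fun _ => rfl⟩, fun _ _ _ _ => rfl⟩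
  add_mem' := by
    rintro F F' ⟨⟨P, hP, h⟩, hi⟩ ⟨⟨P', hP', h'⟩, hi'⟩
    exact ⟨⟨P + P', (polyFun _).add_mem hP hP', fun x => by simp [h, h']⟩,
      fun g x y hy => by simp [hi g x y hy, hi' g x y hy]⟩
  mul_mem' := by
    rintro F F' ⟨⟨P, hP, h⟩, hi⟩ ⟨⟨P', hP', h'⟩, hi'⟩
    exact ⟨⟨P * P', (polyFun _).mul_mem hP hP', fun x => by simp [h, h']⟩,
      fun g x y hy => by simp [hi g x y hy, hi' g x y hy]⟩

/-- The affine quiver variety `𝔐₀(V, W) = μ⁻¹(0) // G_V`, the spectrum of the invariant ring. -/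
def affineQuiverVariety : SpaceWithFunctions.{max u v} :=
  specm (invariantRing q V W)

/-- The point of `𝔐₀(V, W)` given by a point of `μ⁻¹(0)`: evaluation of invariants. -/
def affinePoint (x : zeroFibre q V W) : affineQuiverVariety q V W :=
  (Pi.evalAlgHom ℂ (fun _ => ℂ) x).comp (invariantRing q V W).val

/-- The natural morphism `π : 𝔐(V, W) → 𝔐₀(V, W)`, induced by the inclusion of the stable locus in
`μ⁻¹(0)`. The next lemma shows that it sends an orbit to any (in particular, to the closed) orbit
of `μ⁻¹(0)` in its closure. -/
def projMap : quiverVariety q V W → affineQuiverVariety q V W :=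
  Quotient.lift (fun x : stableLocus q V W => affinePoint q V W ⟨x.1, x.2.1⟩) <| by
    rintro x y ⟨g, hg⟩
    refine AlgHom.ext fun F => ?_
    exact F.2.2 g ⟨y.1, y.2.1⟩ ⟨x.1, x.2.1⟩ hg.symm

/-- The value of `π` at the orbit of `x` is the point of `𝔐₀(V, W)` given by any `y ∈ μ⁻¹(0)` in the
Zariski closure of that orbit. -/
lemma projMap_eq_of_mem_closure (x : stableLocus q V W) (y : zeroFibre q V W)
    (hy : y.1 ∈ @closure (RepSpace q V W) (affineSpace (RepSpace q V W)).top
      (MulAction.orbit (GaugeGroup V) x.1)) :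
    projMap q V W (Quotient.mk (stableSetoid q V W) x) = affinePoint q V W y := by
  refine AlgHom.ext fun F => ?_
  obtain ⟨⟨P, hP, h⟩, hi⟩ := F.2
  change F.1 ⟨x.1, x.2.1⟩ = F.1 y
  by_contra hne
  have hm : P - algebraMap ℂ _ (P x.1) ∈ polyFun (RepSpace q V W) :=
    (polyFun _).sub_mem hP ((polyFun _).algebraMap_mem _)
  have ho : @IsOpen (RepSpace q V W) (affineSpace (RepSpace q V W)).top
      {z | (P - algebraMap ℂ _ (P x.1)) z ≠ 0} :=
    TopologicalSpace.isOpen_generateFrom_of_mem ⟨_, hm, rfl⟩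
  obtain ⟨z, hz, ⟨g, rfl⟩⟩ :=
    (@mem_closure_iff (RepSpace q V W) (affineSpace (RepSpace q V W)).top _ _).1 hy _ ho (by
    intro h0
    apply hne
    rw [h, h]
    exact (sub_eq_zero.1 h0).symm)
  apply hz
  have hgx : g • x.1 ∈ zeroFibre q V W := by
    intro b
    refine LinearMap.ext fun t => ?_
    have := LinearMap.congr_fun (x.2.1 b) ((g b)⁻¹ t)
    change (g (q * (q * b))) (x.1.α (q * b) (x.1.β b ((g b)⁻¹ t))) = 0
    have h0 : x.1.α (q * b) (x.1.β b ((g b)⁻¹ t)) = 0 := this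
    rw [h0, map_zero]
  have := hi g ⟨x.1, x.2.1⟩ ⟨g • x.1, hgx⟩ rfl
  rw [h, h] at this
  exact sub_eq_zero.2 this

end Quiver

/-! ## Grassmannians and varieties of complexes -/

section Complexes

variable (w : ℤ → Type v) [∀ k, AddCommGroup (w k)] [∀ k, Module ℂ (w k)] (d : ℤ → ℕ)

/-- Tuples of linear maps `f k : w k → w (k + 1)`. When only finitely many `w k` are nonzero, this
product over `k` is the direct sum. -/
abbrev HomTuple : Type v := ∀ k : ℤ, w k →ₗ[ℂ] w (k + 1)

/-- The Grassmannian of `r`-dimensional subspaces of `E`. -/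
abbrev Gr (r : ℕ) (E : Type v) [AddCommGroup E] [Module ℂ E] : Type v :=
  {U : Submodule ℂ E // Module.finrank ℂ U = r}

/-- Index set of the standard charts of a Grassmannian: decompositions `E = A ⊕ B`, `dim A = r`. -/
structure GrChart (r : ℕ) (E : Type v) [AddCommGroup E] [Module ℂ E] where
  A : Submodule ℂ E
  B : Submodule ℂ E
  isCompl : IsCompl A B
  finrank_eq : Module.finrank ℂ A = r

/-- The embedding `t ↦ t + h t` of `A` in `A ⊕ B = E`, for `h : A → B`. -/
def GrChart.graphMap {r : ℕ} {E : Type v} [AddCommGroup E] [Module ℂ E] (c : GrChart r E)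
    (h : c.A →ₗ[ℂ] c.B) : c.A →ₗ[ℂ] E :=
  c.A.subtype + c.B.subtype ∘ₗ h

lemma GrChart.graphMap_injective {r : ℕ} {E : Type v} [AddCommGroup E] [Module ℂ E]
    (c : GrChart r E) (h : c.A →ₗ[ℂ] c.B) : Function.Injective (c.graphMap h) := by
  refine (injective_iff_map_eq_zero _).2 fun t ht => ?_
  have h1 : (t : E) + (h t : E) = 0 := ht
  have h2 : (t : E) ∈ c.B := by
    rw [eq_neg_of_add_eq_zero_left h1]
    exact c.B.neg_mem (h t).2
  exact Subtype.ext ((Submodule.disjoint_def.1 c.isCompl.disjoint) _ t.2 h2)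

/-- The standard chart `Hom(A, B) → Gr`, sending `h` to its graph. Its image is the set of
the complements of `B`. -/
def GrChart.graph {r : ℕ} {E : Type v} [AddCommGroup E] [Module ℂ E] (c : GrChart r E)
    (h : c.A →ₗ[ℂ] c.B) : Gr r E :=
  ⟨LinearMap.range (c.graphMap h), by
    rw [LinearMap.finrank_range_of_inj (c.graphMap_injective h), c.finrank_eq]⟩

/-- The variety `⊕ₖ Hom(w k, w (k + 1)) × ∏ₖ Gr_{d k}(w k)`, glued from the affine spaces
`⊕ₖ Hom(w k, w (k + 1)) × ∏ₖ Hom(A k, B k)` along products of standard charts. -/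
def homGrVariety : SpaceWithFunctions.{v} :=
  final (ι := ∀ k, GrChart (d k) (w k))
    (fun c => affineSpace (HomTuple w × ∀ k, (c k).A →ₗ[ℂ] (c k).B))
    (Y := HomTuple w × ∀ k, Gr (d k) (w k)) fun c p => (p.1, fun k => (c k).graph (p.2 k))

/-- The subvariety of all `(f, U)` with `f k (w k) ⊆ U (k + 1)` and `f k (U k) = 0`. -/
def flaggedComplexes : SpaceWithFunctions.{v} :=
  subspace (homGrVariety w d)
    {p : HomTuple w × ∀ k, Gr (d k) (w k) |
      ∀ k, LinearMap.range (p.1 k) ≤ (p.2 (k + 1)).1 ∧ (p.2 k).1.map (p.1 k) = ⊥}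

/-- The subvariety of all complexes `f` with `rk (f k) ≤ r k`. -/
def boundedComplexes (r : ℤ → ℕ) : SpaceWithFunctions.{v} :=
  subspace (affineSpace (HomTuple w))
    {f : HomTuple w | ∀ k, f (k + 1) ∘ₗ f k = 0 ∧ Module.finrank ℂ (LinearMap.range (f k)) ≤ r k}

variable {w d} in
/-- The tuple of linear maps of a pair `(f, U)`. -/
def forget (z : flaggedComplexes w d) : HomTuple w := z.1.1

variable {w} in
/-- The tuple of linear maps underlying a point of the variety of complexes. -/
def complexMaps {r : ℤ → ℕ} (z : boundedComplexes w r) : HomTuple w := z.1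

end Complexes

end RankOneQuiver

end

/-!
# Graded quiver varieties of type `A₁`

Only the spaces `w k = W (q ^ (2 k) a)` and `t k = V (q ^ (2 k - 1) a)` can be nonzero, and they are
indexed by the integers without repetition since `q` is not a root of unity (`repEquiv`). So a point
of `μ⁻¹(0)` consists of maps `α k : w k → t (k + 1)` and `β k : t k → w k` with `α k ∘ β k = 0`, and
both isomorphisms are built from the invariant maps `f k = β (k + 1) ∘ α k` (`composite`).

The orbit of a stable point is determined by `f` and the images `U k` of the injective maps `β k`:
the `U k` determine the `β k` up to `G_V`, and then `α k` is `f k`, as a map to `U (k + 1)`. In a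
chart of the Grassmannian the coordinates of `U k` are rational functions of `β k`, by Cramer's rule
(`isMorphismAt_flagMap`); conversely a coordinate of `U k` gives a choice of `β k`, so the inverse
lifts locally to the stable locus (`localSection`). This is `exists_flagIso`.

For the affine quotient the point is that the invariant ring of the (reduced) fibre `μ⁻¹(0)`
consists of the polynomials in the `f k` (`invariant_eq_polynomial_composite`). This is the first
fundamental theorem of invariant theory, one vertex at a time (`mem_of_invariant`), proved
directly for functions on a subset that is stable under `(α, β) ↦ (g α, β h)` for all matrices
`g`, `h`, so that no Reynolds operator is needed. For invertible `g` an invariant `F` satisfies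
`F (g α, β h) = F (α, β h g)`. If it has degree `n` in `α` and in `β`, it is bilinear in `α^{⊗ n}`
and `β^{⊗ n}`, and the same identity `H (x α^{⊗ n}, β^{⊗ n} y) = H (α^{⊗ n}, β^{⊗ n} y x)` holds
for `x`, `y` in the span of all `g^{⊗ n}`. Now this span contains `x p`, `y p` with
`∑ x p * y p = 1` such that `∑ x p * X * y p` is a combination of permutations of the tensor
factors for every `X` (`exists_separability_idempotent`); hence `F` is obtained from
`β^{⊗ n} σ α^{⊗ n} = σ (β α)^{⊗ n}`, for permutations `σ`. The `x p`, `y p` come from the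
symmetrized matrix units `sym E_ij`: the sum `∑ sym E_ij * X * sym E_ji` is a combination of
permutations by direct computation, and for `X = 1` it is positive definite, hence invertible.

The image of `μ⁻¹(0)` under `f` is the set of complexes with `rk (f k) ≤ dim t (k + 1)`
(`range_composite`), and it is Zariski closed (`complexSet_closed`). A character of an algebra of
pulled back polynomials is therefore a point of this set (`exists_specIso`).
-/

noncomputable section

namespace RankOneQuiver

universe u v w u'

/-! ### Tensor powers of matrices -/

section TensorPower

variable {I J K : Type*} {n : ℕ}

/-- The matrix of the tensor product of the linear maps with matrices `x s`; the basis of a tensor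
power is indexed by functions on `Fin n`. -/
def tensorFamily (x : Fin n → Matrix I J ℂ) : Matrix (Fin n → I) (Fin n → J) ℂ :=
  Matrix.of fun i j => ∏ s, x s (i s) (j s)

/-- The matrix of the `n`-th tensor power of the linear map with matrix `g`. -/
def tensorPow (n : ℕ) (g : Matrix I J ℂ) : Matrix (Fin n → I) (Fin n → J) ℂ :=
  tensorFamily fun _ : Fin n => g

lemma tensorPow_apply (g : Matrix I J ℂ) (i : Fin n → I) (j : Fin n → J) :
    tensorPow n g i j = ∏ s, g (i s) (j s) := rfl

lemma tensorPow_mul [Fintype J] (g : Matrix I J ℂ) (h : Matrix J K ℂ) :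
    tensorPow n (g * h) = tensorPow n g * tensorPow n h := by
  classical
  ext i k
  simp only [tensorPow_apply, Matrix.mul_apply, Fintype.prod_sum, Finset.prod_mul_distrib]

lemma tensorPow_one [DecidableEq I] : tensorPow n (1 : Matrix I I ℂ) = 1 := by
  ext i j
  simp only [tensorPow_apply, Matrix.one_apply, Finset.prod_ite_zero, Finset.prod_const_one,
    funext_iff, Finset.mem_univ, true_imp_iff]

/-- The matrix by which a permutation of the tensor factors acts. -/
def permMatrix (I : Type*) [DecidableEq I] {n : ℕ} (σ : Equiv.Perm (Fin n)) :
    Matrix (Fin n → I) (Fin n → I) ℂ :=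
  Matrix.of fun i j => if i = j ∘ σ then 1 else 0

lemma comp_perm_eq_iff (σ : Equiv.Perm (Fin n)) (i j : Fin n → I) :
    i ∘ σ = j ↔ i = j ∘ (σ⁻¹ : Equiv.Perm (Fin n)) := by
  constructor
  · rintro rfl
    funext s
    simp
  · rintro rfl
    funext s
    simp

/-- The sum of the conjugates of `X` under all permutations of the tensor factors. -/
def symmetrize (X : Matrix (Fin n → I) (Fin n → J) ℂ) : Matrix (Fin n → I) (Fin n → J) ℂ :=
  Matrix.of fun i j => ∑ σ : Equiv.Perm (Fin n), X (i ∘ σ) (j ∘ σ)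

lemma symmetrize_apply (X : Matrix (Fin n → I) (Fin n → J) ℂ) (i : Fin n → I) (j : Fin n → J) :
    symmetrize X i j = ∑ σ : Equiv.Perm (Fin n), X (i ∘ σ) (j ∘ σ) := rfl

lemma symmetrize_comp (X : Matrix (Fin n → I) (Fin n → J) ℂ) (τ : Equiv.Perm (Fin n))
    (i : Fin n → I) (j : Fin n → J) : symmetrize X (i ∘ τ) (j ∘ τ) = symmetrize X i j := by
  simp only [symmetrize_apply]
  exact Fintype.sum_equiv (Equiv.mulLeft τ) _ _ fun σ => rfl

lemma symmetrize_sum {κ : Type*} (S : Finset κ) (X : κ → Matrix (Fin n → I) (Fin n → J) ℂ) :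
    symmetrize (∑ k ∈ S, X k) = ∑ k ∈ S, symmetrize (X k) := by
  ext i j
  simp only [symmetrize_apply, Matrix.sum_apply]
  exact Finset.sum_comm

lemma symmetrize_smul (c : ℂ) (X : Matrix (Fin n → I) (Fin n → J) ℂ) :
    symmetrize (c • X) = c • symmetrize X := by
  ext i j
  simp [symmetrize_apply, Finset.mul_sum]

/-- Polarization: the symmetrization of a pure tensor is a combination of tensor powers. The factor
`∏ t, (2 ε t - 1)` selects the terms in which each of the `x t` occurs. -/
lemma symmetrize_tensorFamily (x : Fin n → Matrix I J ℂ) :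
    symmetrize (tensorFamily x) =
      ∑ ε : Fin n → Fin 2, (∏ t, (2 * ((ε t : ℕ) : ℂ) - 1)) •
        tensorPow n (∑ t, ((ε t : ℕ) : ℂ) • x t) := by
  classical
  ext i j
  have hfactor : ∀ τ : Fin n → Fin n,
      ∑ ε : Fin n → Fin 2, (∏ t, (2 * ((ε t : ℕ) : ℂ) - 1)) * ∏ s, ((ε (τ s) : ℕ) : ℂ)
        = if Function.Bijective τ then 1 else 0 := by
    intro τ
    have h1 : ∀ ε : Fin n → Fin 2,
        (∏ t, (2 * ((ε t : ℕ) : ℂ) - 1)) * ∏ s, ((ε (τ s) : ℕ) : ℂ)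
          = ∏ t, ((2 * ((ε t : ℕ) : ℂ) - 1) *
              ((ε t : ℕ) : ℂ) ^ (Finset.univ.filter fun s => τ s = t).card) := by
      intro ε
      rw [Finset.prod_mul_distrib]
      congr 1
      rw [← Finset.prod_fiberwise (s := Finset.univ) (g := τ)]
      refine Finset.prod_congr rfl fun t _ => ?_
      rw [Finset.prod_congr rfl (g := fun _ => ((ε t : ℕ) : ℂ)), Finset.prod_const]
      intro s hs
      rw [(Finset.mem_filter.1 hs).2]
    simp_rw [h1]
    rw [← Fintype.prod_sum (fun t (e : Fin 2) => (2 * ((e : ℕ) : ℂ) - 1) *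
              ((e : ℕ) : ℂ) ^ (Finset.univ.filter fun s => τ s = t).card)]
    simp only [Fin.sum_univ_two, Fin.val_zero, Fin.val_one, Nat.cast_zero, Nat.cast_one, one_pow,
      mul_one, mul_zero, zero_sub, zero_pow_eq]
    split_ifs with hb
    · refine Finset.prod_eq_one fun t _ => ?_
      obtain ⟨s, hs⟩ := hb.2 t
      rw [if_neg]
      · norm_num
      · exact Finset.card_ne_zero.2 ⟨s, by simp [hs]⟩
    · rw [← Finite.surjective_iff_bijective] at hb
      obtain ⟨t, ht⟩ := not_forall.1 hb
      refine Finset.prod_eq_zero (Finset.mem_univ t) ?_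
      rw [if_pos]
      · norm_num
      · refine Finset.card_eq_zero.2 (Finset.filter_eq_empty_iff.2 fun s _ hs => ht ⟨s, hs⟩)
  have hR : (∑ ε : Fin n → Fin 2, (∏ t, (2 * ((ε t : ℕ) : ℂ) - 1)) •
        tensorPow n (∑ t, ((ε t : ℕ) : ℂ) • x t)) i j =
      ∑ τ : Fin n → Fin n, (if Function.Bijective τ then 1 else 0) *
        ∏ s, x (τ s) (i s) (j s) := by
    simp only [Matrix.sum_apply, Matrix.smul_apply, smul_eq_mul, tensorPow_apply,
      Fintype.prod_sum, Finset.prod_mul_distrib, Finset.mul_sum]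
    rw [Finset.sum_comm]
    refine Finset.sum_congr rfl fun τ _ => ?_
    rw [← hfactor, Finset.sum_mul]
    exact Finset.sum_congr rfl fun ε _ => by ring
  rw [hR, symmetrize_apply]
  simp only [ite_mul, one_mul, zero_mul, ← Finset.sum_filter]
  symm
  refine Finset.sum_bij (fun τ h => (Equiv.ofBijective τ (Finset.mem_filter.1 h).2)⁻¹)
    (fun _ _ => Finset.mem_univ _) ?_ ?_ ?_
  · intro τ _ τ' _ h
    have := inv_injective h
    funext s
    exact congrArg (fun e : Equiv.Perm (Fin n) => e s) this
  · intro σ _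
    refine ⟨⇑(σ⁻¹ : Equiv.Perm (Fin n)), Finset.mem_filter.2 ⟨Finset.mem_univ _, Equiv.bijective _⟩, ?_⟩
    rw [inv_eq_iff_eq_inv]
    ext s
    rfl
  · intro τ h
    set e := Equiv.ofBijective τ (Finset.mem_filter.1 h).2 with he
    change _ = ∏ s, x s (i (e⁻¹ s)) (j (e⁻¹ s))
    rw [← Equiv.prod_comp e (fun s => x s (i (e⁻¹ s)) (j (e⁻¹ s)))]
    refine Finset.prod_congr rfl fun s _ => ?_
    have hs : e⁻¹ (e s) = s := e.symm_apply_apply s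
    simp only [hs]
    rfl

/-- The span of the tensor powers of invertible matrices. -/
def tensorPowSpan (I : Type*) [Fintype I] [DecidableEq I] (n : ℕ) :
    Submodule ℂ (Matrix (Fin n → I) (Fin n → I) ℂ) :=
  Submodule.span ℂ {X | ∃ g : Matrix I I ℂ, IsUnit g ∧ tensorPow n g = X}

variable [Fintype I] [DecidableEq I]

/-- A subspace containing the values of a polynomial curve for infinitely many parameters contains
all of its values; apply this to the curve `t ↦ (g + t)^{⊗ n}`. -/
lemma tensorPow_mem (g : Matrix I I ℂ) : tensorPow n g ∈ tensorPowSpan I n := by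
  by_contra hg
  obtain ⟨l, hl, hl0⟩ := Submodule.exists_le_ker_of_notMem hg
  have hexp : ∀ X : Matrix (Fin n → I) (Fin n → I) ℂ,
      l X = ∑ i, ∑ j, X i j * l (Matrix.single i j 1) := by
    intro X
    conv_lhs => rw [Matrix.matrix_eq_sum_single X]
    simp only [map_sum]
    refine Finset.sum_congr rfl fun i _ => Finset.sum_congr rfl fun j _ => ?_
    rw [← smul_eq_mul, ← map_smul, Matrix.smul_single, smul_eq_mul, mul_one]
  let p : Polynomial ℂ := ∑ i : Fin n → I, ∑ j : Fin n → I,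
    (∏ s, (Polynomial.C (g (i s) (j s)) + Polynomial.C ((1 : Matrix I I ℂ) (i s) (j s)) * Polynomial.X))
      * Polynomial.C (l (Matrix.single i j 1))
  have hp : ∀ t : ℂ, p.eval t = l (tensorPow n (g + t • 1)) := by
    intro t
    rw [hexp]
    simp [p, Polynomial.eval_finsetSum, Polynomial.eval_prod, tensorPow_apply, mul_comm t]
  have hp0 : p = 0 := by
    refine Polynomial.eq_zero_of_infinite_isRoot p ?_
    have hfin : {t : ℂ | (Matrix.charpoly (-g)).IsRoot t}.Finite :=
      Polynomial.finite_setOfPred_isRoot (Matrix.charpoly_monic (-g)).ne_zero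
    refine hfin.infinite_compl.mono fun t ht => ?_
    change p.eval t = 0
    rw [hp]
    refine LinearMap.mem_ker.1 (hl0 (Submodule.subset_span ⟨g + t • 1, ?_, rfl⟩))
    rw [Matrix.isUnit_iff_isUnit_det, isUnit_iff_ne_zero]
    have h2 : (Matrix.charpoly (-g)).eval t ≠ 0 := ht
    rw [Matrix.eval_charpoly] at h2
    convert h2 using 2
    rw [Matrix.scalar_apply, sub_neg_eq_add, add_comm, Matrix.smul_one_eq_diagonal]
  apply hl
  have := hp 0
  rw [hp0, zero_smul, add_zero] at this
  simpa using this.symm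

lemma symmetrize_mem (X : Matrix (Fin n → I) (Fin n → I) ℂ) :
    symmetrize X ∈ tensorPowSpan I n := by
  have hsingle : ∀ i j : Fin n → I, (Matrix.single i j 1 : Matrix (Fin n → I) (Fin n → I) ℂ)
      = tensorFamily fun s => Matrix.single (i s) (j s) 1 := by
    intro i j
    ext k l
    simp only [tensorFamily, Matrix.of_apply, Matrix.single_apply, Finset.prod_ite_zero,
      Finset.prod_const_one, funext_iff, Finset.mem_univ, true_imp_iff, forall_and]
  rw [Matrix.matrix_eq_sum_single X]
  have hsm : ∀ i j, Matrix.single i j (X i j) =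
      X i j • (Matrix.single i j 1 : Matrix (Fin n → I) (Fin n → I) ℂ) := by
    intro i j
    rw [Matrix.smul_single, smul_eq_mul, mul_one]
  simp only [symmetrize_sum, hsm, symmetrize_smul]
  refine Submodule.sum_mem _ fun i _ => Submodule.sum_mem _ fun j _ => Submodule.smul_mem _ _ ?_
  rw [hsingle, symmetrize_tensorFamily]
  exact Submodule.sum_mem _ fun ε _ => Submodule.smul_mem _ _ (tensorPow_mem _)

lemma permMatrix_mul_apply (σ : Equiv.Perm (Fin n)) (X : Matrix (Fin n → I) (Fin n → J) ℂ)
    (i : Fin n → I) (j : Fin n → J) :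
    (permMatrix I σ * X) i j = X (i ∘ (σ⁻¹ : Equiv.Perm (Fin n))) j := by
  rw [Matrix.mul_apply, Finset.sum_eq_single (i ∘ (σ⁻¹ : Equiv.Perm (Fin n)))]
  · simp [permMatrix, Function.comp_assoc]
  · intro k _ hk
    rw [permMatrix, Matrix.of_apply, if_neg, zero_mul]
    intro h
    exact hk ((comp_perm_eq_iff σ k i).1 h.symm)
  · simp

lemma mul_permMatrix_apply (σ : Equiv.Perm (Fin n)) (X : Matrix (Fin n → J) (Fin n → I) ℂ)
    (i : Fin n → J) (j : Fin n → I) : (X * permMatrix I σ) i j = X i (j ∘ σ) := by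
  rw [Matrix.mul_apply, Finset.sum_eq_single (j ∘ σ)]
  · simp [permMatrix]
  · intro k _ hk
    rw [permMatrix, Matrix.of_apply, if_neg hk, mul_zero]
  · simp

/-- The Casimir sum `∑ sym(E_ij) X sym(E_ji)` is a combination of permutation matrices. -/
lemma casimir_mem_span (X : Matrix (Fin n → I) (Fin n → I) ℂ) :
    ∑ p : (Fin n → I) × (Fin n → I),
      symmetrize (Matrix.single p.1 p.2 1) * X * symmetrize (Matrix.single p.2 p.1 1) ∈
    Submodule.span ℂ (Set.range (permMatrix I (n := n))) := by
  have key : ∑ p : (Fin n → I) × (Fin n → I),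
      symmetrize (Matrix.single p.1 p.2 1) * X * symmetrize (Matrix.single p.2 p.1 1) =
      ∑ σ : Equiv.Perm (Fin n), ∑ τ : Equiv.Perm (Fin n),
        (∑ a : Fin n → I, ∑ b : Fin n → I, if b ∘ τ = a ∘ σ then X a b else 0) •
          permMatrix I (τ * σ⁻¹) := by
    ext k l
    have h1 : ∀ (σ τ : Equiv.Perm (Fin n)) (p : (Fin n → I) × (Fin n → I)) (a b : Fin n → I),
        (Matrix.single p.1 p.2 (1 : ℂ) (k ∘ σ) (a ∘ σ)) * X a b *
          (Matrix.single p.2 p.1 (1 : ℂ) (b ∘ τ) (l ∘ τ)) =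
        if p = (k ∘ σ, a ∘ σ) then (if b ∘ τ = a ∘ σ ∧ k ∘ σ = l ∘ τ then X a b else 0) else 0 := by
      intro σ τ p a b
      obtain ⟨p1, p2⟩ := p
      simp only [Matrix.single_apply, Prod.mk.injEq]
      by_cases hp : p1 = k ∘ σ ∧ p2 = a ∘ σ
      · obtain ⟨rfl, rfl⟩ := hp
        simp [eq_comm]
      · rw [if_neg hp, if_neg hp]
        simp
    calc _ = ∑ p : (Fin n → I) × (Fin n → I), ∑ b : Fin n → I, ∑ a : Fin n → I,
              ∑ σ : Equiv.Perm (Fin n), ∑ τ : Equiv.Perm (Fin n),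
              (Matrix.single p.1 p.2 (1 : ℂ) (k ∘ σ) (a ∘ σ)) * X a b *
                (Matrix.single p.2 p.1 (1 : ℂ) (b ∘ τ) (l ∘ τ)) := by
            simp only [Matrix.sum_apply, Matrix.mul_apply, symmetrize_apply, Finset.sum_mul,
              Finset.mul_sum]
            refine Finset.sum_congr rfl fun p _ => Finset.sum_congr rfl fun b _ => ?_
            rw [Finset.sum_comm]
            refine Finset.sum_congr rfl fun a _ => ?_
            rw [Finset.sum_comm]
      _ = ∑ b : Fin n → I, ∑ a : Fin n → I, ∑ σ : Equiv.Perm (Fin n), ∑ τ : Equiv.Perm (Fin n),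
            if b ∘ τ = a ∘ σ ∧ k ∘ σ = l ∘ τ then X a b else 0 := by
            simp only [h1]
            rw [Finset.sum_comm]
            refine Finset.sum_congr rfl fun b _ => ?_
            rw [Finset.sum_comm]
            refine Finset.sum_congr rfl fun a _ => ?_
            rw [Finset.sum_comm]
            refine Finset.sum_congr rfl fun σ _ => ?_
            rw [Finset.sum_comm]
            refine Finset.sum_congr rfl fun τ _ => ?_
            rw [Finset.sum_ite_eq' Finset.univ (k ∘ σ, a ∘ σ), if_pos (Finset.mem_univ _)]
      _ = _ := by
            simp only [Matrix.sum_apply, Matrix.smul_apply, smul_eq_mul, Finset.sum_mul]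
            rw [Finset.sum_comm]
            rw [Finset.sum_congr rfl fun a _ => Finset.sum_comm]
            rw [Finset.sum_comm]
            refine Finset.sum_congr rfl fun σ _ => ?_
            rw [Finset.sum_congr rfl fun a _ => Finset.sum_comm]
            rw [Finset.sum_comm]
            refine Finset.sum_congr rfl fun τ _ => Finset.sum_congr rfl fun a _ =>
              Finset.sum_congr rfl fun b _ => ?_
            have h2 : k ∘ σ = l ∘ τ ↔ k = l ∘ (τ * σ⁻¹ : Equiv.Perm (Fin n)) := by
              rw [comp_perm_eq_iff]; rfl
            simp only [permMatrix, Matrix.of_apply, h2, ite_and, mul_ite, mul_one, mul_zero]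
            split_ifs <;> rfl
  rw [key]
  exact Submodule.sum_mem _ fun σ _ => Submodule.sum_mem _ fun τ _ =>
    Submodule.smul_mem _ _ (Submodule.subset_span ⟨_, rfl⟩)

/-- The Casimir element `∑ sym(E_ij) sym(E_ji) = ∑ sym(E_ij) sym(E_ij)ᴴ`. -/
def casimir (I : Type*) [Fintype I] [DecidableEq I] (n : ℕ) :
    Matrix (Fin n → I) (Fin n → I) ℂ :=
  ∑ p : (Fin n → I) × (Fin n → I),
    symmetrize (Matrix.single p.1 p.2 1) * symmetrize (Matrix.single p.2 p.1 1)

lemma isUnit_casimir : IsUnit (casimir I n) := by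
  have hstar : ∀ p q : Fin n → I, symmetrize (Matrix.single q p (1 : ℂ)) =
      (symmetrize (Matrix.single p q (1 : ℂ))).conjTranspose := by
    intro p q
    ext i j
    simp only [symmetrize_apply, Matrix.conjTranspose_apply, star_sum]
    refine Finset.sum_congr rfl fun σ _ => ?_
    simp only [Matrix.single_apply]
    by_cases h : q = i ∘ σ ∧ p = j ∘ σ
    · rw [if_pos h, if_pos h.symm, star_one]
    · rw [if_neg h, if_neg (fun h' => h h'.symm), star_zero]
  rw [← Matrix.mulVec_injective_iff_isUnit]
  refine (injective_iff_map_eq_zero (Matrix.mulVecLin (casimir I n))).2 fun v hv => ?_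
  -- `v* c v` is the sum of the squared norms of the vectors `sym(E_ji) v`
  have hz : ∑ p : (Fin n → I) × (Fin n → I),
      star (symmetrize (Matrix.single p.2 p.1 (1 : ℂ)) |>.mulVec v) ⬝ᵥ
        (symmetrize (Matrix.single p.2 p.1 (1 : ℂ)) |>.mulVec v) = 0 := by
    have h0 : star v ⬝ᵥ (casimir I n).mulVec v = 0 := by
      have : (casimir I n).mulVec v = 0 := hv
      rw [this, dotProduct_zero]
    rw [casimir, Matrix.sum_mulVec, dotProduct_sum] at h0
    rw [← h0]
    refine Finset.sum_congr rfl fun p _ => ?_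
    rw [Matrix.star_mulVec, ← hstar, ← Matrix.dotProduct_mulVec, Matrix.mulVec_mulVec]
  have hall : ∀ i j : Fin n → I, (symmetrize (Matrix.single i j (1 : ℂ))).mulVec v = 0 := by
    intro i j
    open scoped ComplexOrder in
    have := (Finset.sum_eq_zero_iff_of_nonneg (fun p _ => dotProduct_star_self_nonneg _)).1 hz
      (j, i) (Finset.mem_univ _)
    open scoped ComplexOrder in
    exact dotProduct_star_self_eq_zero.1 this
  have hone : ∑ i : Fin n → I, symmetrize (Matrix.single i i (1 : ℂ)) =
      ((Fintype.card (Equiv.Perm (Fin n)) : ℕ) : ℂ) • (1 : Matrix (Fin n → I) (Fin n → I) ℂ) := by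
    rw [← symmetrize_sum]
    have : ∑ i : Fin n → I, Matrix.single i i (1 : ℂ) = 1 := by
      rw [Matrix.sum_single_eq_diagonal, Matrix.diagonal_one]
    rw [this]
    ext i j
    have hij : ∀ σ : Equiv.Perm (Fin n), i ∘ σ = j ∘ σ ↔ i = j := fun σ =>
      σ.surjective.injective_comp_right.eq_iff
    simp [symmetrize_apply, Matrix.one_apply, hij]
  have h2 : ((Fintype.card (Equiv.Perm (Fin n)) : ℕ) : ℂ) • v = 0 := by
    rw [← Matrix.one_mulVec (((Fintype.card (Equiv.Perm (Fin n)) : ℕ) : ℂ) • v),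
      Matrix.mulVec_smul, ← Matrix.smul_mulVec, ← hone, Matrix.sum_mulVec]
    exact Finset.sum_eq_zero fun i _ => hall i i
  refine (smul_eq_zero.1 h2).resolve_left ?_
  exact Nat.cast_ne_zero.2 Fintype.card_ne_zero

lemma casimir_mem : casimir I n ∈ Submodule.span ℂ (Set.range (permMatrix I (n := n))) := by
  have := casimir_mem_span (1 : Matrix (Fin n → I) (Fin n → I) ℂ)
  simpa only [Matrix.mul_one, casimir] using this

lemma casimir_comp (τ : Equiv.Perm (Fin n)) (i j : Fin n → I) :
    casimir I n (i ∘ τ) (j ∘ τ) = casimir I n i j := by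
  simp only [casimir, Matrix.sum_apply, Matrix.mul_apply]
  refine Finset.sum_congr rfl fun p _ => ?_
  rw [← Equiv.sum_comp (Equiv.arrowCongr τ.symm (Equiv.refl I))
    (fun a => symmetrize (Matrix.single p.1 p.2 (1 : ℂ)) (i ∘ τ) a *
      symmetrize (Matrix.single p.2 p.1 (1 : ℂ)) a (j ∘ τ))]
  refine Finset.sum_congr rfl fun a _ => ?_
  have : (Equiv.arrowCongr τ.symm (Equiv.refl I)) a = a ∘ τ := by
    funext s; simp [Equiv.arrowCongr]
  rw [this, symmetrize_comp, symmetrize_comp]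

lemma casimir_mul_symmetrize (Y : Matrix (Fin n → I) (Fin n → I) ℂ) :
    casimir I n * symmetrize Y = symmetrize Y * casimir I n := by
  refine Submodule.span_induction (p := fun X _ => X * symmetrize Y = symmetrize Y * X)
    ?_ ?_ ?_ ?_ casimir_mem
  · rintro _ ⟨σ, rfl⟩
    ext i j
    rw [permMatrix_mul_apply, mul_permMatrix_apply, ← symmetrize_comp Y σ]
    congr 1
    funext s
    simp
  · simp
  · intro X X' _ _ h h'
    rw [add_mul, mul_add, h, h']
  · intro c X _ h
    rw [Matrix.smul_mul, Matrix.mul_smul, h]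

/-- The algebra spanned by the tensor powers `g^{⊗ n}` has a separability idempotent
`∑ x m ⊗ y m`, and the associated projection `X ↦ ∑ x m * X * y m` maps all matrices to
combinations of permutations. -/
theorem exists_separability_idempotent (I : Type*) [Fintype I] [DecidableEq I] (n : ℕ) :
    ∃ x y : (Fin n → I) × (Fin n → I) → Matrix (Fin n → I) (Fin n → I) ℂ,
      (∀ p, x p ∈ tensorPowSpan I n) ∧ (∀ p, y p ∈ tensorPowSpan I n) ∧ ∑ p, x p * y p = 1 ∧
      ∀ X, ∑ p, x p * X * y p ∈ Submodule.span ℂ (Set.range (permMatrix I (n := n))) := by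
  have hdet : IsUnit (casimir I n).det := (Matrix.isUnit_iff_isUnit_det _).1 isUnit_casimir
  have hcomm : ∀ Y : Matrix (Fin n → I) (Fin n → I) ℂ,
      symmetrize Y * (casimir I n)⁻¹ = (casimir I n)⁻¹ * symmetrize Y := by
    intro Y
    have h1 : (casimir I n)⁻¹ * (casimir I n * symmetrize Y) * (casimir I n)⁻¹ =
        (casimir I n)⁻¹ * (symmetrize Y * casimir I n) * (casimir I n)⁻¹ := by
      rw [casimir_mul_symmetrize]
    rwa [← mul_assoc, Matrix.nonsing_inv_mul _ hdet, one_mul, mul_assoc, mul_assoc,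
      Matrix.mul_nonsing_inv _ hdet, mul_one] at h1
  have hinv : ∀ (τ : Equiv.Perm (Fin n)) (i j : Fin n → I),
      (casimir I n)⁻¹ (i ∘ τ) (j ∘ τ) = (casimir I n)⁻¹ i j := by
    intro τ i j
    let e : (Fin n → I) ≃ (Fin n → I) := Equiv.arrowCongr τ.symm (Equiv.refl I)
    have he : ∀ a, e a = a ∘ τ := fun a => by funext s; simp [e, Equiv.arrowCongr]
    have h1 : (casimir I n).submatrix e e = casimir I n := by
      ext a b
      rw [Matrix.submatrix_apply, he, he, casimir_comp]
    have h2 := Matrix.inv_submatrix_equiv (casimir I n) e e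
    rw [h1] at h2
    conv_rhs => rw [h2, Matrix.submatrix_apply, he, he]
  refine ⟨fun p => symmetrize (Matrix.single p.1 p.2 1) * (casimir I n)⁻¹,
    fun p => symmetrize (Matrix.single p.2 p.1 1), ?_, fun p => symmetrize_mem _, ?_, ?_⟩
  · intro p
    have : symmetrize (Matrix.single p.1 p.2 1) * (casimir I n)⁻¹ =
        symmetrize (Matrix.single p.1 p.2 1 * (casimir I n)⁻¹) := by
      ext i j
      simp only [symmetrize_apply, Matrix.mul_apply, Finset.sum_mul]
      rw [Finset.sum_comm]
      refine Finset.sum_congr rfl fun σ _ => ?_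
      rw [← Equiv.sum_comp (Equiv.arrowCongr σ.symm (Equiv.refl I))
        (fun a => Matrix.single p.1 p.2 (1 : ℂ) (i ∘ σ) a * (casimir I n)⁻¹ a (j ∘ σ))]
      refine Finset.sum_congr rfl fun a _ => ?_
      have : (Equiv.arrowCongr σ.symm (Equiv.refl I)) a = a ∘ σ := by
        funext s; simp [Equiv.arrowCongr]
      rw [this, hinv]
    dsimp only
    rw [this]
    exact symmetrize_mem _
  · calc ∑ p : (Fin n → I) × (Fin n → I), symmetrize (Matrix.single p.1 p.2 1) * (casimir I n)⁻¹ *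
          symmetrize (Matrix.single p.2 p.1 1) = (casimir I n)⁻¹ * casimir I n := by
            rw [casimir, Finset.mul_sum]
            refine Finset.sum_congr rfl fun p _ => ?_
            rw [← casimir, hcomm, mul_assoc]
      _ = 1 := Matrix.nonsing_inv_mul _ hdet
  · intro X
    have := casimir_mem_span ((casimir I n)⁻¹ * X)
    simpa only [mul_assoc] using this

end TensorPower

/-! ### Invariants of one general linear group -/

section OneVertex

variable {Z I J K : Type*} [Fintype I] [Fintype J] [Fintype K]
  (A₀ : Subalgebra ℂ (Z → ℂ)) (a : Z → Matrix I J ℂ) (b : Z → Matrix K I ℂ)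

/-- The function on `Z` that is bihomogeneous of degree `(p, q)` in the entries of `a` and of `b`,
with coefficients `r` in `A₀`. -/
def bihomogeneous (p q : ℕ) :
    (((Fin p → I) × (Fin p → J)) × ((Fin q → K) × (Fin q → I)) → A₀) →ₗ[ℂ] (Z → ℂ) where
  toFun r z := ∑ m, (r m : Z → ℂ) z * tensorPow p (a z) m.1.1 m.1.2 *
    tensorPow q (b z) m.2.1 m.2.2
  map_add' r r' := by
    funext z
    simp [add_mul, Finset.sum_add_distrib]
  map_smul' c r := by
    funext z
    simp [Finset.mul_sum, mul_assoc]

lemma bihomogeneous_apply (p q : ℕ)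
    (r : ((Fin p → I) × (Fin p → J)) × ((Fin q → K) × (Fin q → I)) → A₀) (z : Z) :
    bihomogeneous A₀ a b p q r z = ∑ m, (r m : Z → ℂ) z * tensorPow p (a z) m.1.1 m.1.2 *
      tensorPow q (b z) m.2.1 m.2.2 := rfl

lemma monomial_mem_range (p q : ℕ) (r : A₀) (i : Fin p → I) (j : Fin p → J) (k : Fin q → K)
    (l : Fin q → I) :
    (fun z => (r : Z → ℂ) z * tensorPow p (a z) i j * tensorPow q (b z) k l) ∈
      LinearMap.range (bihomogeneous A₀ a b p q) := by
  classical
  refine ⟨Pi.single ((i, j), (k, l)) r, ?_⟩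
  funext z
  rw [bihomogeneous_apply, Finset.sum_eq_single ((i, j), (k, l))]
  · simp
  · intro m _ hm
    rw [Pi.single_eq_of_ne hm]
    simp
  · simp

/-- The algebra generated by `A₀` and by the entries of `a` and `b` is the sum of its bihomogeneous
parts. -/
lemma adjoin_entries_le : Subalgebra.toSubmodule (Algebra.adjoin ℂ ((A₀ : Set (Z → ℂ)) ∪
      {F | ∃ i j, F = fun z => a z i j} ∪ {F | ∃ k i, F = fun z => b z k i})) ≤
    ⨆ d : ℕ × ℕ, LinearMap.range (bihomogeneous A₀ a b d.1 d.2) := by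
  rw [Algebra.adjoin_eq_span, Submodule.span_le]
  have hmon : ∀ F ∈ Submonoid.closure ((A₀ : Set (Z → ℂ)) ∪
      {F | ∃ i j, F = fun z => a z i j} ∪ {F | ∃ k i, F = fun z => b z k i}),
      ∃ (p q : ℕ) (r : A₀) (i : Fin p → I) (j : Fin p → J) (k : Fin q → K) (l : Fin q → I),
        F = fun z => (r : Z → ℂ) z * tensorPow p (a z) i j * tensorPow q (b z) k l := by
    intro F hF
    induction hF using Submonoid.closure_induction with
    | mem F hF =>
      rcases hF with (hF | ⟨i, j, rfl⟩) | ⟨k, i, rfl⟩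
      · exact ⟨0, 0, ⟨F, hF⟩, Fin.elim0, Fin.elim0, Fin.elim0, Fin.elim0, by
          funext z; simp [tensorPow_apply]⟩
      · exact ⟨1, 0, 1, fun _ => i, fun _ => j, Fin.elim0, Fin.elim0, by
          funext z; simp [tensorPow_apply]⟩
      · exact ⟨0, 1, 1, Fin.elim0, Fin.elim0, fun _ => k, fun _ => i, by
          funext z; simp [tensorPow_apply]⟩
    | one => exact ⟨0, 0, 1, Fin.elim0, Fin.elim0, Fin.elim0, Fin.elim0, by
          funext z; simp [tensorPow_apply]⟩
    | mul F F' _ _ h h' =>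
      obtain ⟨p, q, r, i, j, k, l, rfl⟩ := h
      obtain ⟨p', q', r', i', j', k', l', rfl⟩ := h'
      refine ⟨p + p', q + q', r * r', Fin.append i i', Fin.append j j', Fin.append k k',
        Fin.append l l', ?_⟩
      funext z
      simp only [Pi.mul_apply, tensorPow_apply, Fin.prod_univ_add, Fin.append_left,
        Fin.append_right, MulMemClass.coe_mul]
      ring
  intro F hF
  obtain ⟨p, q, r, i, j, k, l, rfl⟩ := hmon F hF
  exact Submodule.mem_iSup_of_mem (p, q) (monomial_mem_range A₀ a b p q r i j k l)

/-- Coefficients of polynomial identities in a nonzero parameter can be compared. -/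
lemma sum_filter_eq_of_forall_ne_zero {ι ι' : Type*} (D : Finset ι) (D' : Finset ι')
    (c : ι → ℂ) (c' : ι' → ℂ) (e : ι → ℕ) (e' : ι' → ℕ)
    (h : ∀ s : ℂ, s ≠ 0 → ∑ d ∈ D, s ^ e d * c d = ∑ d ∈ D', s ^ e' d * c' d) (N : ℕ) :
    ∑ d ∈ D with e d = N, c d = ∑ d ∈ D' with e' d = N, c' d := by
  let P : Polynomial ℂ := ∑ d ∈ D, Polynomial.C (c d) * Polynomial.X ^ e d
  let P' : Polynomial ℂ := ∑ d ∈ D', Polynomial.C (c' d) * Polynomial.X ^ e' d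
  have hP : P = P' := by
    refine Polynomial.eq_of_infinite_eval_eq P P' ?_
    refine (Set.finite_singleton (0 : ℂ)).infinite_compl.mono fun s hs => ?_
    have := h s hs
    change P.eval s = P'.eval s
    simp only [P, P', Polynomial.eval_finsetSum, Polynomial.eval_mul, Polynomial.eval_C,
      Polynomial.eval_pow, Polynomial.eval_X]
    simpa only [mul_comm] using this
  have := congrArg (fun Q => Polynomial.coeff Q N) hP
  have he : ∀ d, (e d = N) = (N = e d) := fun d => propext eq_comm
  have he' : ∀ d, (e' d = N) = (N = e' d) := fun d => propext eq_comm
  simpa only [P, P', Polynomial.finsetSum_coeff, Polynomial.coeff_C_mul, Polynomial.coeff_X_pow,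
    Finset.sum_filter, mul_ite, mul_one, mul_zero, he, he'] using this

variable [DecidableEq I] {T : Matrix I I ℂ → Matrix I I ℂ → Z → Z}
  (ha : ∀ g h z, a (T g h z) = g * a z) (hb : ∀ g h z, b (T g h z) = b z * h)
  (hA : ∀ r ∈ A₀, ∀ g h z, r (T g h z) = r z)

include ha hb hA

omit [DecidableEq I] in
lemma bihomogeneous_apply_act {p q : ℕ}
    (r : ((Fin p → I) × (Fin p → J)) × ((Fin q → K) × (Fin q → I)) → A₀) (g h : Matrix I I ℂ)
    (z : Z) :
    bihomogeneous A₀ a b p q r (T g h z) = ∑ m, (r m : Z → ℂ) z *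
      (tensorPow p g * tensorPow p (a z)) m.1.1 m.1.2 *
      (tensorPow q (b z) * tensorPow q h) m.2.1 m.2.2 := by
  simp only [bihomogeneous_apply, ha, hb, hA _ (r _).2, tensorPow_mul]

omit [DecidableEq I] in
lemma bihomogeneous_smul_act {p q : ℕ}
    (r : ((Fin p → I) × (Fin p → J)) × ((Fin q → K) × (Fin q → I)) → A₀) (g h : Matrix I I ℂ)
    (s t : ℂ) (z : Z) :
    bihomogeneous A₀ a b p q r (T (s • g) (t • h) z) =
      s ^ p * t ^ q * bihomogeneous A₀ a b p q r (T g h z) := by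
  have hs : ∀ (n : ℕ) (c : ℂ) (x : Matrix I I ℂ), tensorPow n (c • x) = c ^ n • tensorPow n x := by
    intro n c x
    ext i j
    simp [tensorPow_apply, Finset.prod_mul_distrib]
  simp only [bihomogeneous_apply_act A₀ a b ha hb hA, hs, Finset.mul_sum, Matrix.smul_mul,
    Matrix.mul_smul, Matrix.smul_apply, smul_eq_mul]
  exact Finset.sum_congr rfl fun m _ => by ring

/-- The first fundamental theorem for functions of bidegree `(n, n)`. Such a function is
`H z 1 1`, where `H z X Y` is bilinear in the operators `X`, `Y` on the `n`-th tensor power. By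
invariance `H z 1 (x * y) = H z y x` for combinations `x`, `y` of tensor powers, and summing over a
separability idempotent replaces the function by contractions of `a` and `b`. -/
lemma bihomogeneous_mem {n : ℕ}
    (r : ((Fin n → I) × (Fin n → J)) × ((Fin n → K) × (Fin n → I)) → A₀)
    (hinv : ∀ g h z, IsUnit g → bihomogeneous A₀ a b n n r (T g h z) =
      bihomogeneous A₀ a b n n r (T 1 (h * g) z))
    (S : Subalgebra ℂ (Z → ℂ)) (hAS : A₀ ≤ S) (hS : ∀ k j, (fun z => (b z * a z) k j) ∈ S) :
    bihomogeneous A₀ a b n n r ∈ S := by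
  classical
  -- the bilinear form with `H z (g^{⊗ n}) (h^{⊗ n})` the value at `T g h z`
  let H (z : Z) : Matrix (Fin n → I) (Fin n → I) ℂ →ₗ[ℂ] Matrix (Fin n → I) (Fin n → I) ℂ →ₗ[ℂ] ℂ :=
    LinearMap.mk₂ ℂ (fun X Y => ∑ m, (r m : Z → ℂ) z *
      (X * tensorPow n (a z)) m.1.1 m.1.2 * (tensorPow n (b z) * Y) m.2.1 m.2.2)
      (fun X X' Y => by
        simp only [Matrix.add_mul, Matrix.add_apply, mul_add, add_mul, Finset.sum_add_distrib])
      (fun c X Y => by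
        simp only [Matrix.smul_mul, Matrix.smul_apply, smul_eq_mul, mul_left_comm _ c, mul_assoc,
          ← Finset.mul_sum])
      (fun X Y Y' => by
        simp only [Matrix.mul_add, Matrix.add_apply, mul_add, Finset.sum_add_distrib])
      (fun c X Y => by
        simp only [Matrix.mul_smul, Matrix.smul_apply, smul_eq_mul, mul_left_comm _ c,
          ← Finset.mul_sum])
  have hHapply : ∀ z X Y, H z X Y = ∑ m, (r m : Z → ℂ) z *
      (X * tensorPow n (a z)) m.1.1 m.1.2 * (tensorPow n (b z) * Y) m.2.1 m.2.2 :=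
    fun _ _ _ => rfl
  have hH : ∀ z, ∀ X ∈ tensorPowSpan I n, ∀ Y ∈ tensorPowSpan I n, H z X Y = H z 1 (Y * X) := by
    intro z X hX
    induction hX using Submodule.span_induction with
    | mem X hX =>
      obtain ⟨g, hg, rfl⟩ := hX
      intro Y hY
      induction hY using Submodule.span_induction with
      | mem Y hY =>
        obtain ⟨h, hh, rfl⟩ := hY
        have := hinv g h z hg
        rwa [bihomogeneous_apply_act A₀ a b ha hb hA, bihomogeneous_apply_act A₀ a b ha hb hA,
          tensorPow_one, tensorPow_mul h g] at this
      | zero => rw [zero_mul, map_zero, map_zero]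
      | add Y Y' _ _ h h' => rw [add_mul, map_add, map_add, h, h']
      | smul c Y _ h => rw [Matrix.smul_mul, map_smul, map_smul, h]
    | zero =>
      intro Y _
      rw [mul_zero, map_zero, map_zero, LinearMap.zero_apply]
    | add X X' _ _ h h' =>
      intro Y hY
      rw [mul_add, map_add, map_add, LinearMap.add_apply, h Y hY, h' Y hY]
    | smul c X _ h =>
      intro Y hY
      rw [Matrix.mul_smul, map_smul, map_smul, LinearMap.smul_apply, h Y hY]
  obtain ⟨x, y, hx, hy, hxy, hproj⟩ := exists_separability_idempotent I n
  have hH1 : ∀ z, H z 1 1 = ∑ p, H z (y p) (x p) := by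
    intro z
    rw [← hxy, map_sum, hxy]
    exact Finset.sum_congr rfl fun p _ => (hH z _ (hy p) _ (hx p)).symm
  let C : ((Fin n → I) × (Fin n → J)) × ((Fin n → K) × (Fin n → I)) →
      Matrix (Fin n → I) (Fin n → I) ℂ := fun m => ∑ p, x p * Matrix.single m.2.2 m.1.1 1 * y p
  have hF : bihomogeneous A₀ a b n n r = ∑ m, (r m : Z → ℂ) * fun z =>
      (tensorPow n (b z) * C m * tensorPow n (a z)) m.2.1 m.1.2 := by
    funext z
    have h1 : bihomogeneous A₀ a b n n r z = H z 1 1 := by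
      simp only [hHapply, bihomogeneous_apply, Matrix.one_mul, Matrix.mul_one]
    rw [h1, hH1]
    simp only [hHapply, Finset.sum_apply, Pi.mul_apply]
    rw [Finset.sum_comm]
    refine Finset.sum_congr rfl fun m _ => ?_
    rw [Matrix.mul_sum, Matrix.sum_mul, Matrix.sum_apply, Finset.mul_sum]
    refine Finset.sum_congr rfl fun p _ => ?_
    have h2 : tensorPow n (b z) * (x p * Matrix.single m.2.2 m.1.1 (1 : ℂ) * y p) *
        tensorPow n (a z) = (tensorPow n (b z) * x p) * Matrix.single m.2.2 m.1.1 (1 : ℂ) *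
          (y p * tensorPow n (a z)) := by
      simp only [Matrix.mul_assoc]
    have h3 : ∀ (M : Matrix (Fin n → K) (Fin n → I) ℂ) (N : Matrix (Fin n → I) (Fin n → J) ℂ)
        (u : Fin n → K) (l i : Fin n → I) (v : Fin n → J),
        (M * Matrix.single l i (1 : ℂ) * N) u v = M u l * N i v := by
      intro M N u l i v
      rw [Matrix.mul_apply, Finset.sum_eq_single i]
      · simp
      · intro w _ hw
        rw [Matrix.mul_single_apply_of_ne _ _ _ _ _ hw, zero_mul]
      · simp
    rw [h2, h3]
    ring
  rw [hF]
  refine S.sum_mem fun m _ => S.mul_mem (hAS (r m).2) ?_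
  have hC : C m ∈ Submodule.span ℂ (Set.range (permMatrix I (n := n))) := hproj _
  generalize C m = X at hC ⊢
  induction hC using Submodule.span_induction with
  | mem X hX =>
    obtain ⟨σ, rfl⟩ := hX
    have h4 : (fun z => (tensorPow n (b z) * permMatrix I σ * tensorPow n (a z)) m.2.1 m.1.2) =
        ∏ s, fun z => (b z * a z) (m.2.1 s) (m.1.2 (σ s)) := by
      funext z
      have h5 : permMatrix I σ * tensorPow n (a z) =
          Matrix.of fun i j => tensorPow n (a z) i (j ∘ σ) := by
        ext i j
        rw [permMatrix_mul_apply, Matrix.of_apply, tensorPow_apply, tensorPow_apply,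
          ← Equiv.prod_comp σ]
        simp
      rw [Finset.prod_apply, Matrix.mul_assoc, h5]
      exact congrFun (congrFun (tensorPow_mul (n := n) (b z) (a z)) m.2.1) (m.1.2 ∘ σ) |>.symm
    rw [h4]
    exact S.prod_mem fun s _ => hS _ _
  | zero =>
    simp only [Matrix.mul_zero, Matrix.zero_mul, Matrix.zero_apply]
    exact S.zero_mem
  | add X X' _ _ h h' =>
    simp only [Matrix.mul_add, Matrix.add_mul, Matrix.add_apply]
    exact S.add_mem h h'
  | smul c X _ h =>
    simp only [Matrix.mul_smul, Matrix.smul_mul, Matrix.smul_apply]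
    exact S.smul_mem h c

/-- The first fundamental theorem for one general linear group, with coefficients `A₀` on which the
group acts trivially: an invariant polynomial in the entries of `a` and `b` is a polynomial in the
entries of `b * a`. Invariance is formulated through the action of two matrices, on `a` and on `b`
separately, as it then passes to the bihomogeneous components. -/
theorem mem_of_invariant (F : Z → ℂ)
    (hF : F ∈ Algebra.adjoin ℂ ((A₀ : Set (Z → ℂ)) ∪
      {F | ∃ i j, F = fun z => a z i j} ∪ {F | ∃ k i, F = fun z => b z k i}))
    (hinv : ∀ g h z, IsUnit g → F (T g h z) = F (T 1 (h * g) z)) (hT : ∀ z, F (T 1 1 z) = F z)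
    (S : Subalgebra ℂ (Z → ℂ)) (hAS : A₀ ≤ S) (hS : ∀ k j, (fun z => (b z * a z) k j) ∈ S) :
    F ∈ S := by
  classical
  obtain ⟨f, hf, hsum⟩ := (Submodule.mem_iSup_iff_exists_finsupp _ _).1
    (adjoin_entries_le A₀ a b hF)
  have hFz : ∀ z, F z = ∑ d ∈ f.support, f d z := by
    intro z
    rw [← hsum, Finsupp.sum, Finset.sum_apply]
  have hscale : ∀ (d : ℕ × ℕ) (g h : Matrix I I ℂ) (s t : ℂ) (z : Z),
      f d (T (s • g) (t • h) z) = s ^ d.1 * t ^ d.2 * f d (T g h z) := by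
    intro d g h s t z
    obtain ⟨r, hr⟩ := hf d
    rw [← hr]
    exact bihomogeneous_smul_act A₀ a b ha hb hA r g h s t z
  have hone : ∀ (d : ℕ × ℕ) (z : Z), f d (T 1 1 z) = f d z := by
    intro d z
    obtain ⟨r, hr⟩ := hf d
    rw [← hr, bihomogeneous_apply_act A₀ a b ha hb hA]
    simp only [bihomogeneous_apply, tensorPow_one, Matrix.one_mul, Matrix.mul_one]
  let D := f.support.filter fun d => d.1 = d.2
  -- invariance under scalar matrices kills the components of unequal degrees
  have hdiag : ∀ z, F z = ∑ d ∈ D, f d z := by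
    intro z
    let N := f.support.sup fun d => d.2
    have hN : ∀ d ∈ f.support, d.2 ≤ N := fun d hd => Finset.le_sup (f := fun d => d.2) hd
    have := sum_filter_eq_of_forall_ne_zero f.support ({()} : Finset Unit) (fun d => f d z) (fun _ => F z)
      (fun d => d.1 + (N - d.2)) (fun _ => N) (fun s hs => by
        have h1 := hinv (s • 1) (s⁻¹ • 1) z
          ((Matrix.isUnit_iff_isUnit_det _).2 (by simp [hs]))
        have h2 : (s⁻¹ • (1 : Matrix I I ℂ)) * (s • 1) = 1 := by simp [hs]
        rw [h2, hT] at h1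
        rw [Finset.sum_singleton, ← h1, hFz, Finset.mul_sum]
        refine Finset.sum_congr rfl fun d hd => ?_
        rw [hscale, hone, ← mul_assoc]
        congr 1
        have h3 := hN d hd
        obtain ⟨e, he⟩ := Nat.exists_eq_add_of_le h3
        rw [he, Nat.add_sub_cancel_left, inv_pow, pow_add, pow_add]
        field_simp) N
    simp only [Finset.filter_singleton, if_true, Finset.sum_singleton] at this
    rw [← this]
    refine Finset.sum_congr (Finset.filter_congr fun d hd => ?_) fun _ _ => rfl
    have h3 := hN d hd
    omega
  have hFsum : F = ∑ d ∈ D, f d := by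
    funext z
    rw [hdiag, Finset.sum_apply]
  rw [hFsum]
  refine S.sum_mem fun d hd => ?_
  obtain ⟨n, n'⟩ := d
  obtain rfl : n = n' := (Finset.mem_filter.1 hd).2
  -- scaling separates the components of different degrees, so each of them is invariant
  have hcomp : ∀ g h z, IsUnit g → f (n, n) (T g h z) = f (n, n) (T 1 (h * g) z) := by
    intro g h z hg
    have := sum_filter_eq_of_forall_ne_zero D D (fun d => f d (T g h z))
      (fun d => f d (T 1 (h * g) z)) (fun d => d.1) (fun d => d.2) (fun s hs => by
        have h1 := hinv (s • g) h z (by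
          rw [Matrix.isUnit_iff_isUnit_det, Matrix.det_smul]
          exact (IsUnit.mk0 _ (pow_ne_zero _ hs)).mul ((Matrix.isUnit_iff_isUnit_det _).1 hg))
        rw [hdiag, hdiag, Matrix.mul_smul] at h1
        have h2 : ∀ d, f d (T (s • g) h z) = s ^ d.1 * f d (T g h z) := by
          intro d
          have := hscale d g h s 1 z
          rwa [one_smul, one_pow, mul_one] at this
        have h3 : ∀ d, f d (T 1 (s • (h * g)) z) = s ^ d.2 * f d (T 1 (h * g) z) := by
          intro d
          have := hscale d 1 (h * g) 1 s z
          rwa [one_smul, one_pow, one_mul] at this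
        simpa only [h2, h3] using h1) n
    have h4 : (D.filter fun d => d.1 = n) = {(n, n)} := by
      ext ⟨d, d'⟩
      simp only [Finset.mem_filter, Finset.mem_singleton, Prod.mk.injEq]
      constructor
      · rintro ⟨hd', rfl⟩
        exact ⟨rfl, (Finset.mem_filter.1 hd').2.symm⟩
      · rintro ⟨rfl, rfl⟩
        exact ⟨hd, rfl⟩
    have h5 : (D.filter fun d => d.2 = n) = {(n, n)} := by
      rw [← h4]
      exact Finset.filter_congr fun d hd' => by rw [(Finset.mem_filter.1 hd').2]
    rwa [h4, h5, Finset.sum_singleton, Finset.sum_singleton] at this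
  obtain ⟨r, hr⟩ := hf (n, n)
  rw [← hr] at hcomp ⊢
  exact bihomogeneous_mem A₀ a b ha hb hA r hcomp S hAS hS

end OneVertex

/-! ### Morphisms at a point -/

section MorphismAt

/-- A map of spaces with functions that is a morphism near `x`, in terms of germs. -/
def IsMorphismAt (X : SpaceWithFunctions.{u}) (Y : SpaceWithFunctions.{v}) (F : X → Y) (x : X) :
    Prop :=
  ContinuousAt F x ∧ ∀ φ : Y → ℂ, Y.RegularAt φ (F x) → X.RegularAt (fun z => φ (F z)) x

variable {X : SpaceWithFunctions.{u}} {Y : SpaceWithFunctions.{v}} {Y' : SpaceWithFunctions.{w}}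

lemma isMorphism_iff {F : X → Y} : IsMorphism X Y F ↔ ∀ x, IsMorphismAt X Y F x :=
  ⟨fun h x => ⟨h.1.continuousAt, fun φ => h.2 φ x⟩,
    fun h => ⟨continuous_iff_continuousAt.2 fun x => (h x).1, fun φ x => (h x).2 φ⟩⟩

lemma IsMorphismAt.congr {F G : X → Y} {x : X} (h : IsMorphismAt X Y F x)
    (hFG : ∀ᶠ z in 𝓝 x, F z = G z) : IsMorphismAt X Y G x := by
  refine ⟨h.1.congr hFG, fun φ hφ => X.congr ?_ (h.2 φ ?_)⟩
  · filter_upwards [hFG] with z hz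
    rw [hz]
  · rwa [hFG.self_of_nhds]

lemma IsMorphismAt.comp {G : Y → Y'} {F : X → Y} {x : X} (hG : IsMorphismAt Y Y' G (F x))
    (hF : IsMorphismAt X Y F x) : IsMorphismAt X Y' (fun z => G (F z)) x :=
  ⟨ContinuousAt.comp hG.1 hF.1, fun φ hφ => hF.2 _ (hG.2 φ hφ)⟩

lemma isMorphismAt_val (S : Set Y) (x : subspace Y S) :
    IsMorphismAt (subspace Y S) Y (fun z => z.1) x :=
  ⟨continuousAt_subtype_val, fun φ hφ => ⟨φ, hφ, Filter.Eventually.of_forall fun _ => rfl⟩⟩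

lemma IsMorphismAt.codRestrict {S : Set Y} {F : X → subspace Y S} {x : X}
    (h : IsMorphismAt X Y (fun z => (F z).1) x) : IsMorphismAt X (subspace Y S) F x := by
  have hc : ContinuousAt F x := Topology.IsInducing.subtypeVal.continuousAt_iff.2 h.1
  refine ⟨hc, ?_⟩
  rintro φ ⟨ψ, hψ, he⟩
  refine X.congr ?_ (h.2 ψ hψ)
  filter_upwards [hc.eventually he] with z hz
  exact hz.symm

lemma isMorphismAt_final {ι : Type w} (X : ι → SpaceWithFunctions.{u}) {Y : Type v}
    (c : ∀ i, X i → Y) (i : ι) (x : X i) : IsMorphismAt (X i) (final X c) (c i) x := by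
  let _ := finalTopology X c
  exact ⟨(continuous_final X c i).continuousAt,
    fun _ hφ => Filter.Eventually.self_of_nhds hφ i x rfl⟩

lemma isMorphism_of_final {ι : Type w} (X : ι → SpaceWithFunctions.{u}) {Y : Type v}
    (c : ∀ i, X i → Y) {Y' : SpaceWithFunctions.{u'}} (G : final X c → Y')
    (h : ∀ i x, IsMorphismAt (X i) Y' (fun t => G (c i t)) x) : IsMorphism (final X c) Y' G := by
  have hc : Continuous G := continuous_iSup_dom.2 fun i =>
    continuous_coinduced_dom.2 (continuous_iff_continuousAt.2 fun x => (h i x).1)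
  refine ⟨hc, fun φ y hφ => ?_⟩
  have h1 : ∀ᶠ z in 𝓝 y, Y'.RegularAt φ (G z) := hc.continuousAt.eventually (Y'.eventually hφ)
  filter_upwards [h1] with z hz i x hx
  subst hx
  exact (h i x).2 φ hz

end MorphismAt

/-! ### Regular maps to vector spaces -/

section RegularMap

variable {X : SpaceWithFunctions.{u}} {Y : SpaceWithFunctions.{v}}
variable {E F H : Type*} [AddCommGroup E] [Module ℂ E] [AddCommGroup F] [Module ℂ F]
  [AddCommGroup H] [Module ℂ H]

/-- A map to a vector space all of whose coordinates are regular at `x`. -/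
def RegularMapAt (X : SpaceWithFunctions.{u}) {E : Type*} [AddCommGroup E] [Module ℂ E]
    (G : X → E) (x : X) : Prop :=
  ∀ l : Module.Dual ℂ E, X.RegularAt (fun z => l (G z)) x

lemma regularAt_sum {ι : Type*} (S : Finset ι) (φ : ι → X → ℂ) (x : X)
    (h : ∀ i ∈ S, X.RegularAt (φ i) x) : X.RegularAt (fun z => ∑ i ∈ S, φ i z) x := by
  classical
  induction S using Finset.induction_on with
  | empty => simpa using X.const 0 x
  | insert i S hi ih =>
    simp only [Finset.sum_insert hi]
    exact X.add (h i (Finset.mem_insert_self i S))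
      (ih fun j hj => h j (Finset.mem_insert_of_mem hj))

lemma regularAt_prod {ι : Type*} (S : Finset ι) (φ : ι → X → ℂ) (x : X)
    (h : ∀ i ∈ S, X.RegularAt (φ i) x) : X.RegularAt (fun z => ∏ i ∈ S, φ i z) x := by
  classical
  induction S using Finset.induction_on with
  | empty => simpa using X.const 1 x
  | insert i S hi ih =>
    simp only [Finset.prod_insert hi]
    exact X.mul (h i (Finset.mem_insert_self i S))
      (ih fun j hj => h j (Finset.mem_insert_of_mem hj))

lemma RegularMapAt.congr {G G' : X → E} {x : X} (h : RegularMapAt X G x)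
    (he : ∀ᶠ z in 𝓝 x, G z = G' z) : RegularMapAt X G' x := fun l =>
  X.congr (by filter_upwards [he] with z hz; rw [hz]) (h l)

lemma RegularMapAt.const (e : E) (x : X) : RegularMapAt X (fun _ => e) x := fun l => X.const (l e) x

lemma RegularMapAt.add {G G' : X → E} {x : X} (h : RegularMapAt X G x)
    (h' : RegularMapAt X G' x) : RegularMapAt X (fun z => G z + G' z) x := fun l => by
  simpa only [map_add] using X.add (h l) (h' l)

lemma RegularMapAt.sum {ι : Type*} (S : Finset ι) {G : ι → X → E} {x : X}
    (h : ∀ i ∈ S, RegularMapAt X (G i) x) : RegularMapAt X (fun z => ∑ i ∈ S, G i z) x := fun l => by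
  simpa only [map_sum] using regularAt_sum S (fun i z => l (G i z)) x fun i hi => h i hi l

lemma RegularMapAt.smul {φ : X → ℂ} {G : X → E} {x : X} (hφ : X.RegularAt φ x)
    (h : RegularMapAt X G x) : RegularMapAt X (fun z => φ z • G z) x := fun l => by
  simpa only [map_smul, smul_eq_mul] using X.mul hφ (h l)

lemma RegularMapAt.linear {G : X → E} {x : X} (h : RegularMapAt X G x) (L : E →ₗ[ℂ] F) :
    RegularMapAt X (fun z => L (G z)) x := fun l => h (l ∘ₗ L)

lemma RegularMapAt.prodMk {G : X → E} {G' : X → F} {x : X} (h : RegularMapAt X G x)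
    (h' : RegularMapAt X G' x) : RegularMapAt X (fun z => (G z, G' z)) x := by
  have := (h.linear (LinearMap.inl ℂ E F)).add (h'.linear (LinearMap.inr ℂ E F))
  simpa using this

lemma sum_single_eq {ι : Type*} [DecidableEq ι] {E : ι → Type*} [∀ k, AddCommGroup (E k)]
    [∀ k, Module ℂ (E k)] (S : Finset ι) (hS : ∀ k ∉ S, Subsingleton (E k)) (y : ∀ k, E k) :
    ∑ k ∈ S, LinearMap.single ℂ E k (y k) = y := by
  funext k
  by_cases hk : k ∈ S
  · rw [Finset.sum_apply, Finset.sum_eq_single k]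
    · simp
    · intro j _ hj
      simp [Pi.single_eq_of_ne hj.symm]
    · exact fun h => absurd hk h
  · exact (hS k hk).elim _ _

/-- Only finitely many factors of the product may be nonzero: a linear functional on an infinite
product need not be determined by its restrictions to the factors. -/
lemma RegularMapAt.pi {ι : Type*} {E : ι → Type*} [∀ k, AddCommGroup (E k)]
    [∀ k, Module ℂ (E k)] (S : Finset ι) (hS : ∀ k ∉ S, Subsingleton (E k)) {G : X → ∀ k, E k}
    {x : X} (h : ∀ k ∈ S, RegularMapAt X (fun z => G z k) x) : RegularMapAt X G x := by
  classical
  have h1 : RegularMapAt X (fun z => ∑ k ∈ S, LinearMap.single ℂ E k (G z k)) x :=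
    RegularMapAt.sum S fun k hk => (h k hk).linear _
  simpa only [sum_single_eq S hS] using h1

lemma RegularMapAt.bilinear [FiniteDimensional ℂ E] {G : X → E} {G' : X → F} {x : X}
    (h : RegularMapAt X G x) (h' : RegularMapAt X G' x) (B : E →ₗ[ℂ] F →ₗ[ℂ] H) :
    RegularMapAt X (fun z => B (G z) (G' z)) x := by
  let e := Module.finBasis ℂ E
  have h1 : (fun z => B (G z) (G' z)) = fun z => ∑ i, e.coord i (G z) • B (e i) (G' z) := by
    funext z
    conv_lhs => rw [← e.sum_repr (G z)]
    simp only [map_sum, map_smul, LinearMap.sum_apply, LinearMap.smul_apply, Module.Basis.coord_apply]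
  rw [h1]
  exact RegularMapAt.sum _ fun i _ => RegularMapAt.smul (h _) (h'.linear _)

lemma RegularMapAt.comp_linear [FiniteDimensional ℂ E] [FiniteDimensional ℂ F]
    [FiniteDimensional ℂ H] {G : X → F →ₗ[ℂ] H} {G' : X → E →ₗ[ℂ] F} {x : X}
    (h : RegularMapAt X G x) (h' : RegularMapAt X G' x) :
    RegularMapAt X (fun z => G z ∘ₗ G' z) x :=
  RegularMapAt.bilinear h h' (LinearMap.llcomp ℂ E F H)

lemma RegularMapAt.of_basis {ι : Type*} [Fintype ι] (e : Module.Basis ι ℂ E) {G : X → E} {x : X}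
    (h : ∀ i, X.RegularAt (fun z => e.repr (G z) i) x) : RegularMapAt X G x := by
  have h1 : RegularMapAt X (fun z => ∑ i, e.repr (G z) i • e i) x :=
    RegularMapAt.sum _ fun i _ => RegularMapAt.smul (h i) (RegularMapAt.const _ _)
  simpa only [e.sum_repr] using h1

lemma RegularMapAt.pullback {G : Y → E} {f : X → Y} {x : X} (h : RegularMapAt Y G (f x))
    (hf : IsMorphismAt X Y f x) : RegularMapAt X (fun z => G (f z)) x := fun l => hf.2 _ (h l)

lemma regularAt_ofAlgebra {Z : Type v} (A : Subalgebra ℂ (Z → ℂ)) {P : Z → ℂ} (hP : P ∈ A)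
    (x : ofAlgebra A) : (ofAlgebra A).RegularAt P x :=
  ⟨P, hP, 1, A.one_mem, one_ne_zero, Filter.Eventually.of_forall fun y => by simp⟩

lemma dual_mem_polyFun (l : Module.Dual ℂ E) : (l : E → ℂ) ∈ polyFun E :=
  Algebra.subset_adjoin ⟨l, rfl⟩

lemma regularMapAt_id (x : affineSpace E) : RegularMapAt (affineSpace E) (E := E) (fun z => z) x :=
  fun l => regularAt_ofAlgebra _ (dual_mem_polyFun l) x

lemma RegularMapAt.comp_polyFun {G : X → E} {x : X} (h : RegularMapAt X G x) {P : E → ℂ}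
    (hP : P ∈ polyFun E) : X.RegularAt (fun z => P (G z)) x := by
  induction hP using Algebra.adjoin_induction with
  | mem P hP =>
    obtain ⟨l, rfl⟩ := hP
    exact h l
  | algebraMap c => exact X.const c x
  | add P Q _ _ hP hQ => exact X.add hP hQ
  | mul P Q _ _ hP hQ => exact X.mul hP hQ

lemma isMorphismAt_ofAlgebra {Z : Type v} (A : Subalgebra ℂ (Z → ℂ)) {G : X → ofAlgebra A} {x : X}
    (h : ∀ P ∈ A, X.RegularAt (fun z => P (G z)) x) : IsMorphismAt X (ofAlgebra A) G x := by
  have hc : ContinuousAt G x := by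
    refine TopologicalSpace.tendsto_nhds_generateFrom_iff.2 ?_
    rintro _ ⟨P, hP, rfl⟩ hx
    exact X.ne_zero (h P hP) hx
  refine ⟨hc, ?_⟩
  rintro φ ⟨P, hP, Q, hQ, hne, he⟩
  refine X.congr ?_ (X.mul (h P hP) (X.inv (h Q hQ) hne))
  filter_upwards [hc.eventually he] with z hz
  rw [hz, div_eq_mul_inv]

lemma RegularMapAt.isMorphismAt {G : X → affineSpace E} {x : X}
    (h : RegularMapAt X (E := E) G x) : IsMorphismAt X (affineSpace E) G x :=
  isMorphismAt_ofAlgebra (polyFun E) fun _ hP => h.comp_polyFun hP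

lemma RegularMapAt.det {n : ℕ} {G : X → Matrix (Fin n) (Fin n) ℂ} {x : X}
    (h : ∀ i j, X.RegularAt (fun z => G z i j) x) : X.RegularAt (fun z => (G z).det) x := by
  simp only [Matrix.det_apply']
  exact regularAt_sum _ _ x fun σ _ => X.mul (X.const _ x) (regularAt_prod _ _ x fun i _ => h _ _)

lemma regularAt_det [FiniteDimensional ℂ E] {G : X → Module.End ℂ E} {x : X}
    (h : RegularMapAt X G x) : X.RegularAt (fun z => LinearMap.det (G z)) x := by
  let e := Module.finBasis ℂ E
  simp only [← LinearMap.det_toMatrix e]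
  refine RegularMapAt.det fun i j => ?_
  simp only [LinearMap.toMatrix_apply]
  exact h (e.coord i ∘ₗ LinearMap.applyₗ (e j))

lemma eventually_isUnit [FiniteDimensional ℂ E] {G : X → Module.End ℂ E} {x : X}
    (h : RegularMapAt X G x) (hx : IsUnit (G x)) : ∀ᶠ z in 𝓝 x, IsUnit (G z) := by
  have h0 := X.ne_zero (regularAt_det h) ((LinearMap.isUnit_iff_isUnit_det _).1 hx).ne_zero
  filter_upwards [h0] with z hz
  exact (LinearMap.isUnit_iff_isUnit_det _).2 hz.isUnit

/-- Inversion of endomorphisms is regular, by Cramer's rule. -/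
lemma RegularMapAt.ringInverse [FiniteDimensional ℂ E] {G : X → Module.End ℂ E} {x : X}
    (h : RegularMapAt X G x) (hx : IsUnit (G x)) :
    RegularMapAt X (fun z => Ring.inverse (G z)) x := by
  let e := Module.finBasis ℂ E
  let m := LinearMap.toMatrixAlgEquiv e
  have hentry : ∀ i j, X.RegularAt (fun z => m (G z) i j) x := by
    intro i j
    simp only [m, LinearMap.toMatrixAlgEquiv_apply]
    exact h (e.coord i ∘ₗ LinearMap.applyₗ (e j))
  have hdet : X.RegularAt (fun z => (m (G z)).det) x := RegularMapAt.det hentry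
  have hunit : ∀ z, IsUnit (G z) → (m (G z)).det ≠ 0 := fun z hz =>
    ((Matrix.isUnit_iff_isUnit_det _).1 (hz.map m)).ne_zero
  have hinv : ∀ z, IsUnit (G z) →
      m.symm ((m (G z)).det⁻¹ • (m (G z)).adjugate) = Ring.inverse (G z) := by
    intro z hz
    rw [AlgEquiv.symm_apply_eq, ← Ring.inverse_eq_inv', ← Matrix.inv_def]
    refine Matrix.inv_eq_right_inv ?_
    rw [← map_mul, Ring.mul_inverse_cancel _ hz, map_one]
  refine RegularMapAt.congr (RegularMapAt.linear (L := m.symm.toLinearMap)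
    (RegularMapAt.smul (X.inv hdet (hunit x hx)) ?_)) ?_
      (G := fun z => m.symm.toLinearMap ((m (G z)).det⁻¹ • (m (G z)).adjugate))
  · refine RegularMapAt.of_basis (Matrix.stdBasis ℂ _ _) ?_
    rintro ⟨i, j⟩
    have hrepr : ∀ M : Matrix (Fin (Module.finrank ℂ E)) (Fin (Module.finrank ℂ E)) ℂ,
        (Matrix.stdBasis ℂ _ _).repr M (i, j) = M i j := fun M => rfl
    simp only [hrepr, Matrix.adjugate_apply]
    refine RegularMapAt.det fun k l => ?_
    by_cases hk : k = j
    · subst hk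
      simp only [Matrix.updateRow_self]
      exact X.const _ x
    · simp only [Matrix.updateRow_ne hk]
      exact hentry k l
  · filter_upwards [eventually_isUnit h hx] with z hz
    exact hinv z hz

end RegularMap

/-! ### The spectrum of an algebra of pulled back polynomials -/

section Spectrum

variable {E : Type v} [AddCommGroup E] [Module ℂ E] [FiniteDimensional ℂ E] {Z : Type u}

/-- Let `A` consist of the pullbacks of the polynomial functions along `m : Z → E`, and suppose that
the image of `m` is Zariski closed. Then the spectrum of `A` is this image. -/
theorem exists_specIso (m : Z → E) (A : Subalgebra ℂ (Z → ℂ))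
    (hA : ∀ F, F ∈ A ↔ ∃ Q ∈ polyFun E, ∀ z, F z = Q (m z)) (C : Set E)
    (hC : Set.range m = C)
    (hclosed : ∀ e ∉ C, ∃ Q ∈ polyFun E, Q e ≠ 0 ∧ ∀ c ∈ C, Q c = 0) :
    ∃ Ψ : Iso (specm A) (subspace (affineSpace E) C),
      ∀ z, (Ψ.toEquiv ((Pi.evalAlgHom ℂ (fun _ => ℂ) z).comp A.val)).1 = m z := by
  have hmem : ∀ Q ∈ polyFun E, (fun z => Q (m z)) ∈ A := fun Q hQ => (hA _).2 ⟨Q, hQ, fun _ => rfl⟩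
  let pull : polyFun E → A := fun Q => ⟨fun z => Q.1 (m z), hmem Q.1 Q.2⟩
  let pt (χ : A →ₐ[ℂ] ℂ) : E := (Module.evalEquiv ℂ E).symm
    { toFun := fun l => χ (pull ⟨l, dual_mem_polyFun l⟩)
      map_add' := fun l l' => by rw [← map_add]; rfl
      map_smul' := fun c l => by rw [RingHom.id_apply, ← map_smul]; rfl }
  have hpt : ∀ (χ : A →ₐ[ℂ] ℂ) (l : Module.Dual ℂ E),
      l (pt χ) = χ (pull ⟨l, dual_mem_polyFun l⟩) := fun χ l => by
    simp only [pt, Module.apply_evalEquiv_symm_apply]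
    rfl
  have hpoly : ∀ (χ : A →ₐ[ℂ] ℂ) (Q : E → ℂ) (hQ : Q ∈ polyFun E),
      Q (pt χ) = χ (pull ⟨Q, hQ⟩) := by
    intro χ Q hQ
    induction hQ using Algebra.adjoin_induction with
    | mem Q hQ =>
      obtain ⟨l, rfl⟩ := hQ
      exact hpt χ l
    | algebraMap c => exact (χ.commutes c).symm
    | add P Q hP hQ h h' =>
      rw [Pi.add_apply, h, h', ← map_add]
      rfl
    | mul P Q hP hQ h h' =>
      rw [Pi.mul_apply, h, h', ← map_mul]
      rfl
  have hptC : ∀ χ, pt χ ∈ C := by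
    intro χ
    by_contra hχ
    obtain ⟨Q, hQ, hne, hQC⟩ := hclosed _ hχ
    apply hne
    rw [hpoly χ Q hQ]
    have : pull ⟨Q, hQ⟩ = 0 := Subtype.ext (funext fun z => hQC _ (hC ▸ ⟨z, rfl⟩))
    rw [this, map_zero]
  let ev (z : Z) : A →ₐ[ℂ] ℂ := (Pi.evalAlgHom ℂ (fun _ => ℂ) z).comp A.val
  have hev : ∀ z, pt (ev z) = m z := fun z => by
    rw [← sub_eq_zero, ← Module.forall_dual_apply_eq_zero_iff ℂ]
    intro l
    rw [map_sub, hpt, sub_eq_zero]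
    rfl
  have hsec : ∀ c : C, ∃ z, m z = c.1 := fun c => hC.ge c.2
  choose sec hsec using hsec
  let Ψ : (A →ₐ[ℂ] ℂ) ≃ C :=
    { toFun := fun χ => ⟨pt χ, hptC χ⟩
      invFun := fun c => ev (sec c)
      left_inv := fun χ => by
        refine AlgHom.ext fun F => ?_
        obtain ⟨Q, hQ, hFQ⟩ := (hA _).1 F.2
        have hF : F = pull ⟨Q, hQ⟩ := Subtype.ext (funext hFQ)
        change F.1 _ = _
        rw [hFQ, hsec, hF]
        exact hpoly χ Q hQ
      right_inv := fun c => Subtype.ext ((hev _).trans (hsec c)) }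
  refine ⟨⟨Ψ, ?_, ?_⟩, hev⟩
  · refine isMorphism_iff.2 fun χ => IsMorphismAt.codRestrict (RegularMapAt.isMorphismAt fun l => ?_)
    have h1 : (fun χ : specm A => l (pt χ)) =
        fun χ : A →ₐ[ℂ] ℂ => χ (pull ⟨l, dual_mem_polyFun l⟩) := funext fun χ => hpt χ l
    change (specm A).RegularAt (fun χ : specm A => l (pt χ)) χ
    rw [h1]
    exact regularAt_ofAlgebra (Z := A →ₐ[ℂ] ℂ) (AlgHom.pi fun χ : A →ₐ[ℂ] ℂ => χ).range
      ⟨pull ⟨l, dual_mem_polyFun l⟩, rfl⟩ χ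
  · refine isMorphism_iff.2 fun c => isMorphismAt_ofAlgebra _ ?_
    rintro _ ⟨F, rfl⟩
    obtain ⟨Q, hQ, hFQ⟩ := (hA _).1 F.2
    have h1 : (fun c : subspace (affineSpace E) C => (AlgHom.pi fun χ : A →ₐ[ℂ] ℂ => χ) F
        (Ψ.symm c)) = fun c => Q c.1 := by
      funext c
      change F.1 (sec c) = _
      rw [hFQ]
      exact congrArg Q (hsec c)
    change (subspace (affineSpace E) C).RegularAt (fun c : subspace (affineSpace E) C =>
      (AlgHom.pi fun χ : A →ₐ[ℂ] ℂ => χ) F (Ψ.symm c)) c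
    rw [h1]
    exact (isMorphismAt_val (Y := affineSpace E) C c).2 Q (regularAt_ofAlgebra (polyFun E) hQ c.1)

end Spectrum

/-! ### Representations indexed by the integers -/

section IntegerModel

variable (w : ℤ → Type v) (t : ℤ → Type u) [∀ k, AddCommGroup (w k)] [∀ k, Module ℂ (w k)]
  [∀ k, AddCommGroup (t k)] [∀ k, Module ℂ (t k)]

/-- The space of tuples of maps `α k : w k → t (k + 1)` and `β k : t k → w k`. -/
abbrev IntRep : Type (max u v) := (∀ k, w k →ₗ[ℂ] t (k + 1)) × (∀ k, t k →ₗ[ℂ] w k)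

/-- The subset of `IntRep` defined by `α k ∘ β k = 0`. -/
def intZeroFibre : Set (IntRep w t) := {x | ∀ k, x.1 k ∘ₗ x.2 k = 0}

variable {w t}

/-- The action of the product of the general linear groups of the `t k`. -/
def intAct (g : ∀ k, t k ≃ₗ[ℂ] t k) (x : IntRep w t) : IntRep w t :=
  (fun k => (g (k + 1)).toLinearMap ∘ₗ x.1 k, fun k => x.2 k ∘ₗ (g k).symm.toLinearMap)

/-- The invariant maps `β (k + 1) ∘ α k : w k → w (k + 1)`. -/
def composite (x : IntRep w t) : HomTuple w := fun k => x.2 (k + 1) ∘ₗ x.1 k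

lemma composite_intAct (g : ∀ k, t k ≃ₗ[ℂ] t k) (x : IntRep w t) :
    composite (intAct g x) = composite x := by
  funext k
  ext y
  simp [composite, intAct]

section Invariants

/-- The generators of the algebras in the proof of the first fundamental theorem: for `k ∈ T` the
entries of `β (k + 1) ∘ α k`, for the other `k` the entries of `α k` and of `β (k + 1)`; the
indices `k ∈ N` are left out. -/
def partialGenerators (w : ℤ → Type v) (t : ℤ → Type u) [∀ k, AddCommGroup (w k)]
    [∀ k, Module ℂ (w k)] [∀ k, AddCommGroup (t k)] [∀ k, Module ℂ (t k)] (T N : Set ℤ) :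
    Set (intZeroFibre w t → ℂ) :=
  {F | ∃ k ∈ T, k ∉ N ∧ ∃ l : Module.Dual ℂ (w k →ₗ[ℂ] w (k + 1)),
      F = fun x => l (composite x.1 k)} ∪
    {F | ∃ k ∉ T, k ∉ N ∧ ∃ l : Module.Dual ℂ (w k →ₗ[ℂ] t (k + 1)), F = fun x => l (x.1.1 k)} ∪
    {F | ∃ k ∉ T, k ∉ N ∧ ∃ l : Module.Dual ℂ (t (k + 1) →ₗ[ℂ] w (k + 1)),
      F = fun x => l (x.1.2 (k + 1))}

/-- Two endomorphisms of `t (k + 1)` act on `intZeroFibre`, one on `α k` and one on `β (k + 1)`. -/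
def vertexAct (k : ℤ) (g h : Module.End ℂ (t (k + 1))) (x : intZeroFibre w t) :
    intZeroFibre w t :=
  ⟨(Function.update x.1.1 k (g ∘ₗ x.1.1 k),
    Function.update x.1.2 (k + 1) (x.1.2 (k + 1) ∘ₗ h)), by
    intro j
    have h1 : ∀ y, x.1.1 j (x.1.2 j y) = 0 := LinearMap.congr_fun (x.2 j)
    refine LinearMap.ext fun y => ?_
    change (Function.update x.1.1 k (g ∘ₗ x.1.1 k)) j
      ((Function.update x.1.2 (k + 1) (x.1.2 (k + 1) ∘ₗ h)) j y) = 0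
    by_cases hj : j = k
    · subst hj
      rw [Function.update_self, Function.update_of_ne (by omega), LinearMap.comp_apply, h1, map_zero]
    · rw [Function.update_of_ne hj]
      by_cases hj' : j = k + 1
      · subst hj'
        rw [Function.update_self, LinearMap.comp_apply, h1]
      · rw [Function.update_of_ne hj', h1]⟩

variable [∀ k, FiniteDimensional ℂ (w k)] [∀ k, FiniteDimensional ℂ (t k)]

/-- One step of the proof of the first fundamental theorem, at the vertex `t (k + 1)`. -/
lemma mem_adjoin_insert (F : intZeroFibre w t → ℂ)
    (hinv : ∀ (g : ∀ k, t k ≃ₗ[ℂ] t k) (x y : intZeroFibre w t), y.1 = intAct g x.1 → F y = F x)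
    (T : Finset ℤ) (k : ℤ) (hk : k ∉ T)
    (hF : F ∈ Algebra.adjoin ℂ (partialGenerators w t T ∅)) :
    F ∈ Algebra.adjoin ℂ (partialGenerators w t (insert k T : Finset ℤ) ∅) := by
  classical
  let ew := Module.finBasis ℂ (w k)
  let ew' := Module.finBasis ℂ (w (k + 1))
  let et := Module.finBasis ℂ (t (k + 1))
  let a : intZeroFibre w t → Matrix _ _ ℂ := fun x => LinearMap.toMatrix ew et (x.1.1 k)
  let b : intZeroFibre w t → Matrix _ _ ℂ := fun x => LinearMap.toMatrix et ew' (x.1.2 (k + 1))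
  refine mem_of_invariant (Algebra.adjoin ℂ (partialGenerators w t T {k})) a b
    (T := fun g h => vertexAct k (Matrix.toLin et et g) (Matrix.toLin et et h))
    ?_ ?_ ?_ F ?_ ?_ ?_ _ ?_ ?_
  · intro g h x
    simp only [a, vertexAct, Function.update_self]
    rw [LinearMap.toMatrix_comp ew et et, LinearMap.toMatrix_toLin]
  · intro g h x
    simp only [b, vertexAct, Function.update_self]
    rw [LinearMap.toMatrix_comp et et ew', LinearMap.toMatrix_toLin]
  · intro r hr g h x
    induction hr using Algebra.adjoin_induction with
    | mem r hr =>
      rcases hr with (⟨j, hj, hjk, l, rfl⟩ | ⟨j, hj, hjk, l, rfl⟩) | ⟨j, hj, hjk, l, rfl⟩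
      all_goals
        have hjk' : j ≠ k := hjk
        simp only [composite, vertexAct, Function.update_of_ne hjk',
          Function.update_of_ne (show j + 1 ≠ k + 1 by omega)]
    | algebraMap c => rfl
    | add r r' _ _ h h' => rw [Pi.add_apply, Pi.add_apply, h, h']
    | mul r r' _ _ h h' => rw [Pi.mul_apply, Pi.mul_apply, h, h']
  · refine Algebra.adjoin_le ?_ hF
    set A := Algebra.adjoin ℂ ((Algebra.adjoin ℂ (partialGenerators w t T {k}) : Set _) ∪
      {F | ∃ i j, F = fun z => a z i j} ∪ {F | ∃ k i, F = fun z => b z k i}) with hA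
    have hle : ∀ f ∈ partialGenerators w t T {k}, f ∈ A := fun f hf =>
      Algebra.subset_adjoin (Or.inl (Or.inl (Algebra.subset_adjoin hf)))
    rintro f ((⟨j, hj, hjk, l, rfl⟩ | ⟨j, hj, hjk, l, rfl⟩) | ⟨j, hj, hjk, l, rfl⟩)
    · exact hle _ (Or.inl (Or.inl ⟨j, hj, fun h => hk (h ▸ hj), l, rfl⟩))
    · by_cases h : j = k
      · subst h
        have h1 : (fun x : intZeroFibre w t => l (x.1.1 j)) =
            ∑ i, ∑ i', l (Matrix.toLin ew et (Matrix.single i i' 1)) • fun x => a x i i' := by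
          funext x
          conv_lhs => rw [← Matrix.toLin_toMatrix ew et (x.1.1 j),
            Matrix.matrix_eq_sum_single (LinearMap.toMatrix ew et (x.1.1 j))]
          simp only [map_sum, Finset.sum_apply, Pi.smul_apply, smul_eq_mul]
          refine Finset.sum_congr rfl fun i _ => Finset.sum_congr rfl fun i' _ => ?_
          rw [← mul_one (LinearMap.toMatrix ew et (x.1.1 j) i i'), ← smul_eq_mul,
            ← Matrix.smul_single, map_smul, map_smul, smul_eq_mul, mul_comm]
        rw [h1]
        exact A.sum_mem fun i _ => A.sum_mem fun i' _ => A.smul_mem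
          (Algebra.subset_adjoin (Or.inl (Or.inr ⟨i, i', rfl⟩))) _
      · exact hle _ (Or.inl (Or.inr ⟨j, hj, h, l, rfl⟩))
    · by_cases h : j = k
      · subst h
        have h1 : (fun x : intZeroFibre w t => l (x.1.2 (j + 1))) =
            ∑ i, ∑ i', l (Matrix.toLin et ew' (Matrix.single i i' 1)) • fun x => b x i i' := by
          funext x
          conv_lhs => rw [← Matrix.toLin_toMatrix et ew' (x.1.2 (j + 1)),
            Matrix.matrix_eq_sum_single (LinearMap.toMatrix et ew' (x.1.2 (j + 1)))]
          simp only [map_sum, Finset.sum_apply, Pi.smul_apply, smul_eq_mul]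
          refine Finset.sum_congr rfl fun i _ => Finset.sum_congr rfl fun i' _ => ?_
          rw [← mul_one (LinearMap.toMatrix et ew' (x.1.2 (j + 1)) i i'), ← smul_eq_mul,
            ← Matrix.smul_single, map_smul, map_smul, smul_eq_mul, mul_comm]
        rw [h1]
        exact A.sum_mem fun i _ => A.sum_mem fun i' _ => A.smul_mem
          (Algebra.subset_adjoin (Or.inr ⟨i, i', rfl⟩)) _
      · exact hle _ (Or.inr ⟨j, hj, h, l, rfl⟩)
  · rintro _ h x ⟨g, rfl⟩
    let e : t (k + 1) ≃ₗ[ℂ] t (k + 1) := LinearEquiv.ofLinearMap (Matrix.toLin et et g.val)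
      (Matrix.toLin et et g.inv)
      (by rw [← Matrix.toLin_mul, g.val_inv, Matrix.toLin_one])
      (by rw [← Matrix.toLin_mul, g.inv_val, Matrix.toLin_one])
    refine hinv (Function.update (fun _ => LinearEquiv.refl ℂ _) (k + 1) e) _ _ ?_
    refine Prod.ext (funext fun j => ?_) (funext fun j => ?_)
    · by_cases hj : j = k
      · subst hj
        simp only [vertexAct, intAct, Function.update_self]
        rw [Matrix.toLin_one]
        rfl
      · simp only [vertexAct, intAct, Function.update_of_ne hj,
          Function.update_of_ne (show j + 1 ≠ k + 1 by omega)]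
        rfl
    · by_cases hj : j = k + 1
      · subst hj
        simp only [vertexAct, intAct, Function.update_self]
        refine LinearMap.ext fun y => ?_
        change x.1.2 (k + 1) (Matrix.toLin et et h y) =
          x.1.2 (k + 1) (Matrix.toLin et et (h * g.val) (Matrix.toLin et et g.inv y))
        rw [← LinearMap.comp_apply (Matrix.toLin et et (h * g.val)), ← Matrix.toLin_mul, mul_assoc,
          g.val_inv, mul_one]
      · simp only [vertexAct, intAct, Function.update_of_ne hj]
        rfl
  · intro x
    congr 1
    refine Subtype.ext ?_
    simp only [vertexAct, Matrix.toLin_one, LinearMap.id_comp, LinearMap.comp_id,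
      Function.update_eq_self]
  · refine Algebra.adjoin_mono ?_
    rintro f ((⟨j, hj, hjk, l, rfl⟩ | ⟨j, hj, hjk, l, rfl⟩) | ⟨j, hj, hjk, l, rfl⟩)
    · exact Or.inl (Or.inl ⟨j, by simp [Finset.mem_coe.1 hj], id, l, rfl⟩)
    · have hjk' : j ≠ k := hjk
      exact Or.inl (Or.inr ⟨j, by simpa [hjk'] using hj, id, l, rfl⟩)
    · have hjk' : j ≠ k := hjk
      exact Or.inr ⟨j, by simpa [hjk'] using hj, id, l, rfl⟩
  · intro i j
    refine Algebra.subset_adjoin (Or.inl (Or.inl ⟨k, by simp, id,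
      (LinearMap.toMatrix ew ew').toLinearMap.dualMap
        (LinearMap.proj j ∘ₗ LinearMap.proj i), ?_⟩))
    funext x
    simp only [a, b]
    rw [← LinearMap.toMatrix_comp ew et ew']
    rfl

/-- The first fundamental theorem for `intZeroFibre`: the invariant polynomial functions are the
polynomials in the maps `β (k + 1) ∘ α k`. -/
theorem invariant_eq_polynomial_composite (S : Finset ℤ) (hw : ∀ k ∉ S, Subsingleton (w k))
    (ht : ∀ k ∉ S, Subsingleton (t k)) (F : intZeroFibre w t → ℂ)
    (hF : ∃ P ∈ polyFun (IntRep w t), ∀ x, F x = P x.1)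
    (hinv : ∀ (g : ∀ k, t k ≃ₗ[ℂ] t k) (x y : intZeroFibre w t), y.1 = intAct g x.1 → F y = F x) :
    ∃ Q ∈ polyFun (HomTuple w), ∀ x, F x = Q (composite x.1) := by
  classical
  have h0 : F ∈ Algebra.adjoin ℂ (partialGenerators w t (∅ : Finset ℤ) ∅) := by
    obtain ⟨P, hP, hFP⟩ := hF
    obtain rfl : F = fun x => P x.1 := funext hFP
    clear hFP hinv
    induction hP using Algebra.adjoin_induction with
    | mem P hP =>
      obtain ⟨l, rfl⟩ := hP
      have h1 : (fun x : intZeroFibre w t => l x.1) =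
          (∑ k ∈ S, fun x => (l ∘ₗ LinearMap.inl ℂ _ _ ∘ₗ LinearMap.single ℂ _ k) (x.1.1 k)) +
          ∑ k ∈ S, fun x => (l ∘ₗ LinearMap.inr ℂ _ _ ∘ₗ LinearMap.single ℂ _ k) (x.1.2 k) := by
        funext x
        have hα : ∀ k ∉ S, Subsingleton (w k →ₗ[ℂ] t (k + 1)) := fun k hk => by
          have := hw k hk
          infer_instance
        have hβ : ∀ k ∉ S, Subsingleton (t k →ₗ[ℂ] w k) := fun k hk => by
          have := ht k hk
          infer_instance
        simp only [Pi.add_apply, Finset.sum_apply, LinearMap.comp_apply, ← map_sum, ← map_add,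
          sum_single_eq S hα, sum_single_eq S hβ]
        simp
      rw [h1]
      refine Subalgebra.add_mem _ (Subalgebra.sum_mem _ fun k _ => ?_)
        (Subalgebra.sum_mem _ fun k _ => ?_)
      · exact Algebra.subset_adjoin (Or.inl (Or.inr ⟨k, by simp, id, _, rfl⟩))
      · obtain ⟨j, rfl⟩ : ∃ j, k = j + 1 := ⟨k - 1, by omega⟩
        exact Algebra.subset_adjoin (Or.inr ⟨j, by simp, id, _, rfl⟩)
    | algebraMap c => exact Subalgebra.algebraMap_mem _ c
    | add P Q _ _ h h' => exact Subalgebra.add_mem _ h h'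
    | mul P Q _ _ h h' => exact Subalgebra.mul_mem _ h h'
  have hall : ∀ T : Finset ℤ, F ∈ Algebra.adjoin ℂ (partialGenerators w t T ∅) := by
    intro T
    induction T using Finset.induction_on with
    | empty => exact h0
    | insert k T hk ih => exact mem_adjoin_insert F hinv T k hk ih
  have hT := hall (S ∪ S.image fun k => k - 1)
  clear h0 hall hF hinv
  induction hT using Algebra.adjoin_induction with
  | mem F hF =>
    rcases hF with (⟨k, _, _, l, rfl⟩ | ⟨k, hk, _, l, rfl⟩) | ⟨k, hk, _, l, rfl⟩
    · exact ⟨_, dual_mem_polyFun (l ∘ₗ LinearMap.proj k), fun x => rfl⟩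
    · have hk' : k ∉ S := fun h => hk (by simp [h])
      have := hw k hk'
      refine ⟨0, Subalgebra.zero_mem _, fun x => ?_⟩
      have h0 : x.1.1 k = 0 := LinearMap.ext fun y => by
        rw [Subsingleton.elim y 0, map_zero, map_zero]
      simp [h0]
    · have hk' : k + 1 ∉ S := fun h => hk (by simpa using Or.inr ⟨k + 1, h, by ring⟩)
      have := ht _ hk'
      refine ⟨0, Subalgebra.zero_mem _, fun x => ?_⟩
      have h0 : x.1.2 (k + 1) = 0 := LinearMap.ext fun y => by
        rw [Subsingleton.elim y 0, map_zero, map_zero]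
      simp [h0]
  | algebraMap c => exact ⟨_, Subalgebra.algebraMap_mem _ c, fun x => rfl⟩
  | add F F' _ _ h h' =>
    obtain ⟨Q, hQ, h⟩ := h
    obtain ⟨Q', hQ', h'⟩ := h'
    exact ⟨_, Subalgebra.add_mem _ hQ hQ', fun x => by simp [h, h']⟩
  | mul F F' _ _ h h' =>
    obtain ⟨Q, hQ, h⟩ := h
    obtain ⟨Q', hQ', h'⟩ := h'
    exact ⟨_, Subalgebra.mul_mem _ hQ hQ', fun x => by simp [h, h']⟩

end Invariants

end IntegerModel

/-! ### Complexes with bounded ranks -/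

section BoundedComplexes

variable {w : ℤ → Type v} {t : ℤ → Type u} [∀ k, AddCommGroup (w k)] [∀ k, Module ℂ (w k)]
  [∀ k, AddCommGroup (t k)] [∀ k, Module ℂ (t k)]
  [∀ k, FiniteDimensional ℂ (w k)] [∀ k, FiniteDimensional ℂ (t k)]

/-- The complexes `f` with `rk (f k) ≤ r k`. -/
def complexSet (w : ℤ → Type v) [∀ k, AddCommGroup (w k)] [∀ k, Module ℂ (w k)] (r : ℤ → ℕ) :
    Set (HomTuple w) :=
  {f | ∀ k, f (k + 1) ∘ₗ f k = 0 ∧ Module.finrank ℂ (LinearMap.range (f k)) ≤ r k}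

/-- A linear map of rank at most `dim T` factors through `T`, with image and kernel unchanged. -/
lemma exists_factorization {E F T : Type*} [AddCommGroup E] [Module ℂ E] [AddCommGroup F]
    [Module ℂ F] [AddCommGroup T] [Module ℂ T] [FiniteDimensional ℂ E] [FiniteDimensional ℂ F]
    [FiniteDimensional ℂ T] (f : E →ₗ[ℂ] F)
    (hf : Module.finrank ℂ (LinearMap.range f) ≤ Module.finrank ℂ T) :
    ∃ (α : E →ₗ[ℂ] T) (β : T →ₗ[ℂ] F), β ∘ₗ α = f ∧ LinearMap.range β ≤ LinearMap.range f ∧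
      LinearMap.ker f ≤ LinearMap.ker α := by
  obtain ⟨i, hi⟩ := (finrank_le_iff_exists_linearMap
    (R := ℂ) (M := LinearMap.range f) (M' := T)).1 hf
  obtain ⟨p, hp⟩ := i.exists_leftInverse_of_injective (LinearMap.ker_eq_bot.2 hi)
  refine ⟨i ∘ₗ f.rangeRestrict, (LinearMap.range f).subtype ∘ₗ p, ?_, ?_, ?_⟩
  · refine LinearMap.ext fun x => ?_
    have := LinearMap.congr_fun hp (f.rangeRestrict x)
    change ((p (i (f.rangeRestrict x)) : LinearMap.range f) : F) = f x
    have h2 : p (i (f.rangeRestrict x)) = f.rangeRestrict x := this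
    rw [h2]
    rfl
  · rintro _ ⟨y, rfl⟩
    exact (p y).2
  · intro x hx
    have : f.rangeRestrict x = 0 := Subtype.ext hx
    change i (f.rangeRestrict x) = 0
    rw [this, map_zero]

lemma exists_shift (P : ℤ → Type*) (y : ∀ k, P (k + 1)) : ∃ z : ∀ k, P k, ∀ k, z (k + 1) = y k :=
  ⟨Equiv.piCongrLeft P (Equiv.addRight (1 : ℤ)) y, fun k =>
    Equiv.piCongrLeft_apply_apply P (Equiv.addRight (1 : ℤ)) y k⟩

lemma range_composite (r : ℤ → ℕ) (hr : ∀ k, r k = Module.finrank ℂ (t (k + 1))) :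
    Set.range (fun x : intZeroFibre w t => composite x.1) = complexSet w r := by
  ext f
  constructor
  · rintro ⟨x, rfl⟩ k
    constructor
    · refine LinearMap.ext fun y => ?_
      have := LinearMap.congr_fun (x.2 (k + 1)) (x.1.1 k y)
      change x.1.2 (k + 1 + 1) (x.1.1 (k + 1) (x.1.2 (k + 1) (x.1.1 k y))) = 0
      have h2 : x.1.1 (k + 1) (x.1.2 (k + 1) (x.1.1 k y)) = 0 := this
      rw [h2, map_zero]
    · rw [hr]
      refine (Submodule.finrank_mono (LinearMap.range_comp_le_range (x.1.1 k) (x.1.2 (k + 1)))).trans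
        (LinearMap.finrank_range_le _)
  · intro hf
    choose α β hβα hβ hα using fun k =>
      exists_factorization (T := t (k + 1)) (f k) ((hf k).2.trans_eq (hr k))
    obtain ⟨β', hβ'⟩ := exists_shift (fun k => t k →ₗ[ℂ] w k) β
    refine ⟨⟨(α, β'), fun k => ?_⟩, funext fun k => ?_⟩
    · obtain ⟨j, rfl⟩ : ∃ j, k = j + 1 := ⟨k - 1, by omega⟩
      refine LinearMap.ext fun y => ?_
      change α (j + 1) (β' (j + 1) y) = 0
      rw [hβ']
      refine hα (j + 1) ?_
      obtain ⟨y', hy'⟩ := hβ j ⟨y, rfl⟩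
      rw [← hy']
      exact LinearMap.congr_fun (hf j).1 y'
    · change β' (k + 1) ∘ₗ α k = f k
      rw [hβ', hβα]

omit [∀ k, FiniteDimensional ℂ (w k)] in
lemma apply_mem_polyFun (k : ℤ) (l : Module.Dual ℂ (w (k + 1))) (y : w k) :
    (fun f : HomTuple w => l (f k y)) ∈ polyFun (HomTuple w) :=
  dual_mem_polyFun (l ∘ₗ LinearMap.applyₗ (R := ℂ) (M₂ := w (k + 1)) y ∘ₗ
    (LinearMap.proj k : HomTuple w →ₗ[ℂ] w k →ₗ[ℂ] w (k + 1)))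

/-- The conditions `f (k + 1) ∘ f k = 0` and `rk (f k) ≤ r k` are polynomial. For the second one,
`rk (f k) ≥ n` if and only if some composition `ℂⁿ → w k → w (k + 1) → ℂⁿ` is invertible. -/
lemma complexSet_closed (r : ℤ → ℕ) (f : HomTuple w) (hf : f ∉ complexSet w r) :
    ∃ Q ∈ polyFun (HomTuple w), Q f ≠ 0 ∧ ∀ c ∈ complexSet w r, Q c = 0 := by
  obtain ⟨k, hk⟩ := not_forall.1 hf
  by_cases h1 : f (k + 1) ∘ₗ f k = 0
  · have h2 : r k < Module.finrank ℂ (LinearMap.range (f k)) := by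
      by_contra h
      exact hk ⟨h1, not_lt.1 h⟩
    let n := Module.finrank ℂ (LinearMap.range (f k))
    let e := Module.finBasis ℂ (LinearMap.range (f k))
    choose y hy using fun i => (e i).2
    obtain ⟨p, hp⟩ := (LinearMap.range (f k)).subtype.exists_leftInverse_of_injective
      (Submodule.ker_subtype _)
    let M (c : HomTuple w) : Matrix (Fin n) (Fin n) ℂ :=
      Matrix.of fun i j => (e.coord i ∘ₗ p) (c k (y j))
    have hMf : M f = 1 := by
      ext i j
      have h3 : p (f k (y j)) = e j := by
        rw [hy]
        exact LinearMap.congr_fun hp (e j)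
      simp only [M, Matrix.of_apply, LinearMap.comp_apply, h3, Module.Basis.coord_apply,
        Module.Basis.repr_self, Finsupp.single_apply, Matrix.one_apply]
      simp only [eq_comm]
    refine ⟨fun c => (M c).det, ?_, ?_, ?_⟩
    · have h4 : (fun c => (M c).det) = ∑ σ : Equiv.Perm (Fin n),
          ((Equiv.Perm.sign σ : ℤ) : ℂ) • ∏ i, fun c : HomTuple w =>
            (e.coord (σ i) ∘ₗ p) (c k (y i)) := by
        funext c
        simp [Matrix.det_apply', M, Finset.prod_apply]
      rw [h4]
      exact Subalgebra.sum_mem _ fun σ _ => Subalgebra.smul_mem _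
        (Subalgebra.prod_mem _ fun i _ => apply_mem_polyFun k (e.coord (σ i) ∘ₗ p) (y i)) _
    · simp [hMf]
    · intro c hc
      by_contra hdet
      have h5 : n ≤ Module.finrank ℂ (LinearMap.range (c k)) := by
        have h6 : LinearIndependent ℂ fun j => c k (y j) := by
          have h7 := Matrix.linearIndependent_cols_of_det_ne_zero hdet
          refine LinearIndependent.of_comp (LinearMap.pi fun i => e.coord i ∘ₗ p) ?_
          exact h7
        have h8 := finrank_span_eq_card h6
        rw [Fintype.card_fin] at h8
        refine h8.symm.le.trans ?_
        refine Submodule.finrank_mono (Submodule.span_le.2 ?_)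
        rintro _ ⟨j, rfl⟩
        exact ⟨y j, rfl⟩
      exact absurd (h2.trans_le (h5.trans (hc k).2)) (lt_irrefl _)
  · obtain ⟨y, hy⟩ : ∃ y, f (k + 1) (f k y) ≠ 0 := by
      by_contra h
      refine h1 (LinearMap.ext fun y => ?_)
      by_contra h'
      exact h ⟨y, h'⟩
    obtain ⟨l, hl⟩ : ∃ l : Module.Dual ℂ (w (k + 1 + 1)), l (f (k + 1) (f k y)) ≠ 0 := by
      by_contra h
      push Not at h
      exact hy ((Module.forall_dual_apply_eq_zero_iff ℂ _).1 h)
    refine ⟨fun c => l (c (k + 1) (c k y)), ?_, hl, ?_⟩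
    · let e := Module.finBasis ℂ (w (k + 1))
      have h2 : (fun c : HomTuple w => l (c (k + 1) (c k y))) =
          ∑ i, (fun c : HomTuple w => e.coord i (c k y)) * fun c => l (c (k + 1) (e i)) := by
        funext c
        conv_lhs => rw [← e.sum_repr (c k y)]
        simp only [map_sum, map_smul, smul_eq_mul, Finset.sum_apply, Pi.mul_apply,
          Module.Basis.coord_apply]
      rw [h2]
      exact Subalgebra.sum_mem _ fun i _ => Subalgebra.mul_mem _ (apply_mem_polyFun k _ _)
        (apply_mem_polyFun (k + 1) _ _)
    · intro c hc
      have := LinearMap.congr_fun (hc k).1 y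
      change l ((c (k + 1) ∘ₗ c k) y) = 0
      rw [this]
      simp

end BoundedComplexes

/-! ### Charts of Grassmannians -/

section Charts

variable {E : Type v} [AddCommGroup E] [Module ℂ E] {r : ℕ} (c : GrChart r E)
  {T : Type u} [AddCommGroup T] [Module ℂ T] (θ : T ≃ₗ[ℂ] c.A)

/-- The projection of `E = A ⊕ B` to `A`. -/
def GrChart.projA : E →ₗ[ℂ] c.A := c.A.projectionOnto c.B c.isCompl

/-- The projection of `E = A ⊕ B` to `B`. -/
def GrChart.projB : E →ₗ[ℂ] c.B := c.B.projectionOnto c.A c.isCompl.symm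

lemma GrChart.projA_add_projB (x : E) : (c.projA x : E) + c.projB x = x :=
  Submodule.projection_add_projection_eq_self c.isCompl x

lemma GrChart.projA_graphMap (h : c.A →ₗ[ℂ] c.B) (y : c.A) : c.projA (c.graphMap h y) = y := by
  change c.projA ((y : E) + (h y : E)) = y
  rw [map_add, GrChart.projA, Submodule.projectionOnto_apply_left,
    Submodule.projectionOnto_apply_right, add_zero]

lemma GrChart.projB_graphMap (h : c.A →ₗ[ℂ] c.B) (y : c.A) : c.projB (c.graphMap h y) = h y := by
  change c.projB ((y : E) + (h y : E)) = h y
  rw [map_add, GrChart.projB, Submodule.projectionOnto_apply_left,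
    Submodule.projectionOnto_apply_right, zero_add]

lemma GrChart.graphMap_projA {h : c.A →ₗ[ℂ] c.B} {x : E} (hx : x ∈ (c.graph h).1) :
    c.graphMap h (c.projA x) = x := by
  obtain ⟨y, rfl⟩ := hx
  rw [c.projA_graphMap]

lemma GrChart.graph_injective : Function.Injective c.graph := by
  intro h h' hh
  refine LinearMap.ext fun y => ?_
  have h1 : c.graphMap h y ∈ (c.graph h').1 := hh ▸ ⟨y, rfl⟩
  have h2 := c.graphMap_projA h1
  rw [c.projA_graphMap] at h2
  rw [← c.projB_graphMap h', h2, c.projB_graphMap]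

lemma GrChart.graph_zero : (c.graph 0).1 = c.A := by
  have h1 : c.graphMap 0 = c.A.subtype := by
    rw [GrChart.graphMap, LinearMap.comp_zero, add_zero]
  change LinearMap.range (c.graphMap 0) = c.A
  rw [h1, Submodule.range_subtype]

/-- The component in `A` of a map `b : T → A ⊕ B`, as an endomorphism of `A ≃ T`. The image of `b`
lies in the chart if and only if this is invertible. -/
def GrChart.componentA (b : T →ₗ[ℂ] E) : Module.End ℂ c.A := c.projA ∘ₗ b ∘ₗ θ.symm.toLinearMap

/-- The coordinate in the chart of the image of `b : T → A ⊕ B`. -/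
def GrChart.coord (b : T →ₗ[ℂ] E) : c.A →ₗ[ℂ] c.B :=
  c.projB ∘ₗ b ∘ₗ θ.symm.toLinearMap ∘ₗ Ring.inverse (c.componentA θ b)

lemma GrChart.graphMap_coord {b : T →ₗ[ℂ] E} (hb : IsUnit (c.componentA θ b)) :
    c.graphMap (c.coord θ b) = b ∘ₗ θ.symm.toLinearMap ∘ₗ Ring.inverse (c.componentA θ b) := by
  refine LinearMap.ext fun y => ?_
  have h1 : c.componentA θ b (Ring.inverse (c.componentA θ b) y) = y :=
    LinearMap.congr_fun (Ring.mul_inverse_cancel _ hb) y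
  have h2 := c.projA_add_projB (b (θ.symm (Ring.inverse (c.componentA θ b) y)))
  have h3 : c.projA (b (θ.symm (Ring.inverse (c.componentA θ b) y))) = y := h1
  rw [h3] at h2
  exact h2

lemma GrChart.graph_coord {b : T →ₗ[ℂ] E} (hb : IsUnit (c.componentA θ b)) :
    (c.graph (c.coord θ b)).1 = LinearMap.range b := by
  change LinearMap.range (c.graphMap (c.coord θ b)) = _
  rw [c.graphMap_coord θ hb]
  refine LinearMap.range_comp_of_range_eq_top _ (LinearMap.range_eq_top.2 ?_)
  refine θ.symm.surjective.comp fun y => ⟨c.componentA θ b y, ?_⟩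
  exact LinearMap.congr_fun (Ring.inverse_mul_cancel _ hb) y

lemma GrChart.isUnit_componentA [FiniteDimensional ℂ E] {b : T →ₗ[ℂ] E}
    (hb : Function.Injective b) {h : c.A →ₗ[ℂ] c.B} (hbh : LinearMap.range b = (c.graph h).1) :
    IsUnit (c.componentA θ b) := by
  rw [LinearMap.isUnit_iff_ker_eq_bot, LinearMap.ker_eq_bot']
  intro y hy
  have h1 : b (θ.symm y) ∈ (c.graph h).1 := hbh ▸ ⟨_, rfl⟩
  have h2 := c.graphMap_projA h1
  have h3 : c.projA (b (θ.symm y)) = 0 := hy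
  rw [h3, map_zero] at h2
  have h4 : θ.symm y = 0 := hb (by rw [← h2, map_zero])
  simpa using h4

variable [FiniteDimensional ℂ E] [FiniteDimensional ℂ T] {X : SpaceWithFunctions.{w}}

lemma RegularMapAt.componentA {b : X → T →ₗ[ℂ] E} {x : X} (hb : RegularMapAt X b x) :
    RegularMapAt X (fun z => c.componentA θ (b z)) x :=
  (RegularMapAt.const _ x).comp_linear (hb.comp_linear (RegularMapAt.const _ x))

lemma RegularMapAt.coord {b : X → T →ₗ[ℂ] E} {x : X} (hb : RegularMapAt X b x)
    (hx : IsUnit (c.componentA θ (b x))) : RegularMapAt X (fun z => c.coord θ (b z)) x :=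
  (RegularMapAt.const _ x).comp_linear (hb.comp_linear
    ((RegularMapAt.const _ x).comp_linear ((hb.componentA c θ).ringInverse hx)))

lemma RegularMapAt.graphMap {h : X → c.A →ₗ[ℂ] c.B} {x : X} (hh : RegularMapAt X h x) :
    RegularMapAt X (fun z => c.graphMap (h z)) x :=
  (RegularMapAt.const _ x).add ((RegularMapAt.const _ x).comp_linear hh)

omit [FiniteDimensional ℂ E] in
/-- Every subspace is the origin of some chart. -/
lemma exists_grChart (U : Gr r E) : ∃ c : GrChart r E, c.graph 0 = U := by
  obtain ⟨B, hB⟩ := U.1.exists_isCompl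
  exact ⟨⟨U.1, B, hB, U.2⟩, Subtype.ext (GrChart.graph_zero _)⟩

end Charts

section ProductCharts

variable {w : ℤ → Type v} [∀ k, AddCommGroup (w k)] [∀ k, Module ℂ (w k)] {d : ℤ → ℕ}

/-- The product of charts of `homGrVariety`. -/
def homGrChart (c : ∀ k, GrChart (d k) (w k)) (p : HomTuple w × ∀ k, (c k).A →ₗ[ℂ] (c k).B) :
    HomTuple w × ∀ k, Gr (d k) (w k) :=
  (p.1, fun k => (c k).graph (p.2 k))

lemma homGrChart_injective (c : ∀ k, GrChart (d k) (w k)) :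
    Function.Injective (homGrChart c) := by
  rintro ⟨f, h⟩ ⟨f', h'⟩ heq
  refine Prod.ext (Prod.mk.inj heq).1 (funext fun k => (c k).graph_injective ?_)
  exact congrFun (Prod.mk.inj heq).2 k

lemma isMorphismAt_homGrChart (c : ∀ k, GrChart (d k) (w k))
    (p : affineSpace (HomTuple w × ∀ k, (c k).A →ₗ[ℂ] (c k).B)) :
    IsMorphismAt _ (homGrVariety w d) (homGrChart c) p :=
  isMorphismAt_final (fun c : ∀ k, GrChart (d k) (w k) =>
    affineSpace (HomTuple w × ∀ k, (c k).A →ₗ[ℂ] (c k).B)) (fun c => homGrChart c) c p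

variable [∀ k, FiniteDimensional ℂ (w k)] (S : Finset ℤ) (hw : ∀ k ∉ S, Subsingleton (w k))

section Transition

variable (c c' : ∀ k, GrChart (d k) (w k))

/-- An identification used to write the transition functions between two charts. -/
def chartEquiv (k : ℤ) : (c' k).A ≃ₗ[ℂ] (c k).A :=
  LinearEquiv.ofFinrankEq _ _ ((c' k).finrank_eq.trans (c k).finrank_eq.symm)

/-- The `A`-component, in the chart `c`, of the graph with coordinate `p` in the chart `c'`. -/
def transitionA (p : HomTuple w × ∀ k, (c' k).A →ₗ[ℂ] (c' k).B) (k : ℤ) :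
    Module.End ℂ (c k).A :=
  (c k).componentA (chartEquiv c c' k) ((c' k).graphMap (p.2 k))

/-- The transition function from the chart `c'` to the chart `c`. -/
def transition (p : HomTuple w × ∀ k, (c' k).A →ₗ[ℂ] (c' k).B) :
    HomTuple w × ∀ k, (c k).A →ₗ[ℂ] (c k).B :=
  (p.1, fun k => (c k).coord (chartEquiv c c' k) ((c' k).graphMap (p.2 k)))

variable {c c'}

lemma homGrChart_transition {p : HomTuple w × ∀ k, (c' k).A →ₗ[ℂ] (c' k).B}
    (hp : ∀ k, IsUnit (transitionA c c' p k)) :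
    homGrChart c (transition c c' p) = homGrChart c' p :=
  Prod.ext rfl (funext fun k => Subtype.ext ((c k).graph_coord _ (hp k)))

lemma mem_range_homGrChart_iff {p : HomTuple w × ∀ k, (c' k).A →ₗ[ℂ] (c' k).B} :
    homGrChart c' p ∈ Set.range (homGrChart c) ↔ ∀ k, IsUnit (transitionA c c' p k) := by
  refine ⟨?_, fun h => ⟨_, homGrChart_transition h⟩⟩
  rintro ⟨p', hp'⟩ k
  refine (c k).isUnit_componentA _ ((c' k).graphMap_injective _) (h := p'.2 k) ?_
  exact (congrArg Subtype.val (congrFun (congrArg Prod.snd hp') k)).symm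

lemma regularMapAt_chart_coordinate (p : affineSpace (HomTuple w × ∀ k, (c' k).A →ₗ[ℂ] (c' k).B))
    (k : ℤ) : RegularMapAt (affineSpace (HomTuple w × ∀ k, (c' k).A →ₗ[ℂ] (c' k).B))
      (fun z => (c' k).graphMap (z.2 k)) p :=
  RegularMapAt.graphMap (c' k) ((regularMapAt_id p).linear (LinearMap.proj k ∘ₗ LinearMap.snd ℂ _ _))

include hw

lemma eventually_isUnit_transitionA {X : SpaceWithFunctions.{u}} {T : ℤ → Type u'}
    [∀ k, AddCommGroup (T k)] [∀ k, Module ℂ (T k)] [∀ k, FiniteDimensional ℂ (T k)]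
    (θ : ∀ k, T k ≃ₗ[ℂ] (c k).A) {b : X → ∀ k, T k →ₗ[ℂ] w k} {x : X}
    (hb : ∀ k, RegularMapAt X (fun z => b z k) x)
    (hx : ∀ k, IsUnit ((c k).componentA (θ k) (b x k))) :
    ∀ᶠ z in 𝓝 x, ∀ k, IsUnit ((c k).componentA (θ k) (b z k)) := by
  have h1 : ∀ᶠ z in 𝓝 x, ∀ k ∈ S, IsUnit ((c k).componentA (θ k) (b z k)) :=
    (Filter.eventually_all_finset S).2 fun k _ =>
      eventually_isUnit ((hb k).componentA (c k) (θ k)) (hx k)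
  filter_upwards [h1] with z hz k
  by_cases hk : k ∈ S
  · exact hz k hk
  · have := hw k hk
    exact isUnit_of_subsingleton _

lemma isOpen_range_homGrChart :
    @IsOpen _ (homGrVariety w d).top (Set.range (homGrChart c)) := by
  refine isOpen_iSup_iff.2 fun c' => isOpen_coinduced.2 (isOpen_iff_mem_nhds.2 fun p hp => ?_)
  have h1 := eventually_isUnit_transitionA S hw (c := c) (chartEquiv c c')
    (X := affineSpace (HomTuple w × ∀ k, (c' k).A →ₗ[ℂ] (c' k).B))
    (b := fun z k => (c' k).graphMap (z.2 k)) (x := p) (regularMapAt_chart_coordinate p)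
    (mem_range_homGrChart_iff.1 hp)
  filter_upwards [h1] with z hz
  exact mem_range_homGrChart_iff.2 hz

omit [∀ k, FiniteDimensional ℂ (w k)] in
lemma regularMapAt_chart_pi {X : SpaceWithFunctions.{u}} {f : X → HomTuple w}
    {h : X → ∀ k, (c k).A →ₗ[ℂ] (c k).B} {x : X} (hf : ∀ k, RegularMapAt X (fun z => f z k) x)
    (hh : ∀ k, RegularMapAt X (fun z => h z k) x) :
    RegularMapAt X (fun z => (f z, h z)) x := by
  refine RegularMapAt.prodMk (RegularMapAt.pi S (fun k hk => ?_) fun k _ => hf k)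
    (RegularMapAt.pi S (fun k hk => ?_) fun k _ => hh k)
  · have := hw k hk
    infer_instance
  · have := hw k hk
    infer_instance

end Transition

open Classical in
/-- The inverse of the chart `homGrChart c`, extended by zero. -/
def chartCoordinate (c : ∀ k, GrChart (d k) (w k)) (z : HomTuple w × ∀ k, Gr (d k) (w k)) :
    HomTuple w × ∀ k, (c k).A →ₗ[ℂ] (c k).B :=
  if h : z ∈ Set.range (homGrChart c) then h.choose else 0

omit [∀ k, FiniteDimensional ℂ (w k)] in
lemma homGrChart_chartCoordinate {c : ∀ k, GrChart (d k) (w k)}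
    {z : HomTuple w × ∀ k, Gr (d k) (w k)} (h : z ∈ Set.range (homGrChart c)) :
    homGrChart c (chartCoordinate c z) = z := by
  rw [chartCoordinate, dif_pos h]
  exact h.choose_spec

include hw in
lemma regularMapAt_chartCoordinate (c : ∀ k, GrChart (d k) (w k)) (z : homGrVariety w d)
    (hz : z ∈ Set.range (homGrChart c)) :
    RegularMapAt (homGrVariety w d) (chartCoordinate c) z := by
  intro l
  have hopen := isOpen_range_homGrChart S hw (c := c)
  change ∀ᶠ z' in @nhds _ (homGrVariety w d).top z, ∀ c' : ∀ k, GrChart (d k) (w k),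
    ∀ p : affineSpace (HomTuple w × ∀ k, (c' k).A →ₗ[ℂ] (c' k).B), homGrChart c' p = z' →
      (affineSpace (HomTuple w × ∀ k, (c' k).A →ₗ[ℂ] (c' k).B)).RegularAt
        (fun t => l (chartCoordinate c (homGrChart c' t))) p
  filter_upwards [hopen.mem_nhds hz] with z' hz' c' p hp
  subst hp
  have hp := mem_range_homGrChart_iff.1 hz'
  have h1 := eventually_isUnit_transitionA S hw (c := c) (chartEquiv c c')
    (X := affineSpace (HomTuple w × ∀ k, (c' k).A →ₗ[ℂ] (c' k).B))
    (b := fun z k => (c' k).graphMap (z.2 k)) (x := p) (regularMapAt_chart_coordinate p) hp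
  have h2 : RegularMapAt (affineSpace (HomTuple w × ∀ k, (c' k).A →ₗ[ℂ] (c' k).B))
      (transition c c') p :=
    regularMapAt_chart_pi S hw
      (fun k => (regularMapAt_id p).linear (LinearMap.proj k ∘ₗ LinearMap.fst ℂ _ _))
      (fun k => (regularMapAt_chart_coordinate p k).coord _ _ (hp k))
  refine h2.congr ?_ l
  filter_upwards [h1] with t ht
  refine homGrChart_injective c ?_
  rw [homGrChart_transition ht, homGrChart_chartCoordinate (mem_range_homGrChart_iff.2 ht)]

end ProductCharts

/-! ### The quotient of the stable locus -/

section StableQuotient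

variable {w : ℤ → Type v} {t : ℤ → Type u} [∀ k, AddCommGroup (w k)] [∀ k, Module ℂ (w k)]
  [∀ k, AddCommGroup (t k)] [∀ k, Module ℂ (t k)]

/-- The subset of `intZeroFibre` where all `β k` are injective. -/
def intStable (w : ℤ → Type v) (t : ℤ → Type u) [∀ k, AddCommGroup (w k)] [∀ k, Module ℂ (w k)]
    [∀ k, AddCommGroup (t k)] [∀ k, Module ℂ (t k)] : Set (IntRep w t) :=
  {x | x ∈ intZeroFibre w t ∧ ∀ k, Function.Injective (x.2 k)}

/-- The pair `(β (k + 1) ∘ α k, im (β k))` of a stable point. -/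
def flagMap (x : IntRep w t) (hx : x ∈ intStable w t) :
    flaggedComplexes w (fun k => Module.finrank ℂ (t k)) :=
  ⟨(composite x, fun k => ⟨LinearMap.range (x.2 k), LinearMap.finrank_range_of_inj (hx.2 k)⟩),
    fun k => by
      refine ⟨LinearMap.range_comp_le_range _ _, ?_⟩
      change (LinearMap.range (x.2 k)).map (x.2 (k + 1) ∘ₗ x.1 k) = ⊥
      rw [← LinearMap.range_comp, LinearMap.comp_assoc, hx.1 k, LinearMap.comp_zero,
        LinearMap.range_zero]⟩

lemma flagMap_congr {x y : IntRep w t} (hx : x ∈ intStable w t) (hy : y ∈ intStable w t)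
    (h : x = y) : flagMap x hx = flagMap y hy := by
  subst h
  rfl

/-- Two stable points with the same image lie in one orbit: both `β k` are isomorphisms onto the
same subspace, which determines `g k`. -/
lemma exists_intAct_of_flagMap_eq {x y : IntRep w t} {hx : x ∈ intStable w t}
    {hy : y ∈ intStable w t} (h : flagMap x hx = flagMap y hy) :
    ∃ g : ∀ k, t k ≃ₗ[ℂ] t k, x = intAct g y := by
  have h1 : composite x = composite y := congrArg (fun z => z.1.1) h
  have h2 : ∀ k, LinearMap.range (y.2 k) = LinearMap.range (x.2 k) := fun k =>
    congrArg (fun z => (z.1.2 k).1) h.symm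
  let g (k : ℤ) : t k ≃ₗ[ℂ] t k := (LinearEquiv.ofInjective (y.2 k) (hy.2 k)).trans
    ((LinearEquiv.ofEq _ _ (h2 k)).trans (LinearEquiv.ofInjective (x.2 k) (hx.2 k)).symm)
  have hg : ∀ k e, x.2 k (g k e) = y.2 k e := by
    intro k e
    have := LinearEquiv.apply_symm_apply (LinearEquiv.ofInjective (x.2 k) (hx.2 k))
      (LinearEquiv.ofEq _ _ (h2 k) (LinearEquiv.ofInjective (y.2 k) (hy.2 k) e))
    exact congrArg Subtype.val this
  refine ⟨g, Prod.ext (funext fun k => LinearMap.ext fun e => hx.2 (k + 1) ?_)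
    (funext fun k => LinearMap.ext fun e => ?_)⟩
  · change _ = x.2 (k + 1) (g (k + 1) (y.1 k e))
    rw [hg]
    exact LinearMap.congr_fun (congrFun h1 k) e
  · change x.2 k e = y.2 k ((g k).symm e)
    rw [← hg, LinearEquiv.apply_symm_apply]

lemma flagMap_intAct {x y : IntRep w t} {hx : x ∈ intStable w t} {hy : y ∈ intStable w t}
    {g : ∀ k, t k ≃ₗ[ℂ] t k} (h : x = intAct g y) : flagMap x hx = flagMap y hy := by
  subst h
  refine Subtype.ext (Prod.ext (composite_intAct g y) (funext fun k => Subtype.ext ?_))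
  change LinearMap.range (y.2 k ∘ₗ (g k).symm.toLinearMap) = _
  rw [LinearMap.range_comp, LinearEquiv.range, Submodule.map_top]
  rfl

section LocalSection

variable (c : ∀ k, GrChart (Module.finrank ℂ (t k)) (w k)) (θ : ∀ k, t k ≃ₗ[ℂ] (c k).A)

/-- A point of `IntRep` over the point `p` of a chart: `β k` is the embedding of `t k` as the
subspace with coordinate `p.2 k`, and `α k` is `p.1 k`, as a map to that subspace. -/
def localSection (p : HomTuple w × ∀ k, (c k).A →ₗ[ℂ] (c k).B) : IntRep w t :=
  (fun k => (θ (k + 1)).symm.toLinearMap ∘ₗ (c (k + 1)).projA ∘ₗ p.1 k,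
    fun k => (c k).graphMap (p.2 k) ∘ₗ (θ k).toLinearMap)

lemma localSection_mem {p : HomTuple w × ∀ k, (c k).A →ₗ[ℂ] (c k).B}
    {z : flaggedComplexes w (fun k => Module.finrank ℂ (t k))} (h : homGrChart c p = z.1) :
    localSection c θ p ∈ intStable w t := by
  have h1 : ∀ k, p.1 k = z.1.1 k := fun k => congrFun (congrArg Prod.fst h) k
  have h2 : ∀ k, (c k).graph (p.2 k) = z.1.2 k := fun k => congrFun (congrArg Prod.snd h) k
  refine ⟨fun k => LinearMap.ext fun e => ?_, fun k =>
    ((c k).graphMap_injective _).comp (θ k).injective⟩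
  have h3 : z.1.1 k ((c k).graphMap (p.2 k) (θ k e)) = 0 := by
    rw [← Submodule.mem_bot ℂ, ← (z.2 k).2]
    exact ⟨_, h2 k ▸ ⟨θ k e, rfl⟩, rfl⟩
  change (θ (k + 1)).symm ((c (k + 1)).projA (p.1 k ((c k).graphMap (p.2 k) (θ k e)))) = 0
  rw [h1, h3, map_zero, map_zero]

lemma flagMap_localSection {p : HomTuple w × ∀ k, (c k).A →ₗ[ℂ] (c k).B}
    {z : flaggedComplexes w (fun k => Module.finrank ℂ (t k))} (h : homGrChart c p = z.1) :
    flagMap (localSection c θ p) (localSection_mem c θ h) = z := by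
  have h1 : ∀ k, p.1 k = z.1.1 k := fun k => congrFun (congrArg Prod.fst h) k
  have h2 : ∀ k, (c k).graph (p.2 k) = z.1.2 k := fun k => congrFun (congrArg Prod.snd h) k
  refine Subtype.ext (Prod.ext (funext fun k => LinearMap.ext fun e => ?_)
    (funext fun k => Subtype.ext ?_))
  · change (c (k + 1)).graphMap (p.2 (k + 1)) (θ (k + 1) ((θ (k + 1)).symm
      ((c (k + 1)).projA (p.1 k e)))) = z.1.1 k e
    rw [LinearEquiv.apply_symm_apply, h1]
    refine (c (k + 1)).graphMap_projA ?_
    rw [h2]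
    exact (z.2 k).1 ⟨e, rfl⟩
  · rw [← h2]
    change LinearMap.range ((c k).graphMap (p.2 k) ∘ₗ (θ k).toLinearMap) = _
    rw [LinearMap.range_comp, LinearEquiv.range, Submodule.map_top]
    rfl

end LocalSection

variable [∀ k, FiniteDimensional ℂ (w k)] [∀ k, FiniteDimensional ℂ (t k)] (S : Finset ℤ)
  (hw : ∀ k ∉ S, Subsingleton (w k)) (ht : ∀ k ∉ S, Subsingleton (t k))

include hw

/-- In the charts around a point, the map `flagMap` is given by rational functions. -/
lemma isMorphismAt_flagMap {X : SpaceWithFunctions.{u'}} (G : X → IntRep w t)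
    (hG : ∀ x, G x ∈ intStable w t) (x : X)
    (hα : ∀ k, RegularMapAt X (fun z => (G z).1 k) x)
    (hβ : ∀ k, RegularMapAt X (fun z => (G z).2 k) x) :
    IsMorphismAt X (flaggedComplexes w fun k => Module.finrank ℂ (t k))
      (fun z => flagMap (G z) (hG z)) x := by
  choose c hc using fun k => exists_grChart ((flagMap (G x) (hG x)).1.2 k)
  let θ (k : ℤ) : t k ≃ₗ[ℂ] (c k).A := LinearEquiv.ofFinrankEq _ _ (c k).finrank_eq.symm
  have hx : ∀ k, IsUnit ((c k).componentA (θ k) ((G x).2 k)) := fun k =>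
    (c k).isUnit_componentA _ ((hG x).2 k) (h := 0) (congrArg Subtype.val (hc k)).symm
  have h1 := eventually_isUnit_transitionA S hw θ hβ hx
  let p (z : X) : HomTuple w × ∀ k, (c k).A →ₗ[ℂ] (c k).B :=
    (composite (G z), fun k => (c k).coord (θ k) ((G z).2 k))
  have h2 : RegularMapAt X p x := regularMapAt_chart_pi S hw
    (fun k => (hβ (k + 1)).comp_linear (hα k)) (fun k => (hβ k).coord (c k) (θ k) (hx k))
  refine IsMorphismAt.codRestrict ?_
  refine IsMorphismAt.congr (F := fun z => homGrChart c (p z))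
    ((isMorphismAt_homGrChart c (p x)).comp h2.isMorphismAt) ?_
  filter_upwards [h1] with z hz
  exact Prod.ext rfl (funext fun k => Subtype.ext ((c k).graph_coord _ (hz k)))

include ht

lemma regularMapAt_localSection {X : SpaceWithFunctions.{u'}}
    (c : ∀ k, GrChart (Module.finrank ℂ (t k)) (w k)) (θ : ∀ k, t k ≃ₗ[ℂ] (c k).A)
    {p : X → HomTuple w × ∀ k, (c k).A →ₗ[ℂ] (c k).B} {x : X} (hp : RegularMapAt X p x) :
    RegularMapAt X (fun z => localSection c θ (p z)) x := by
  have hf : ∀ k, RegularMapAt X (fun z => (p z).1 k) x := fun k =>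
    hp.linear (LinearMap.proj k ∘ₗ LinearMap.fst ℂ _ _)
  have hh : ∀ k, RegularMapAt X (fun z => (p z).2 k) x := fun k =>
    hp.linear (LinearMap.proj k ∘ₗ LinearMap.snd ℂ _ _)
  have hα : ∀ k, RegularMapAt X
      (fun z => (θ (k + 1)).symm.toLinearMap ∘ₗ (c (k + 1)).projA ∘ₗ (p z).1 k) x := fun k =>
    (RegularMapAt.const _ x).comp_linear ((RegularMapAt.const _ x).comp_linear (hf k))
  have hβ : ∀ k, RegularMapAt X
      (fun z => (c k).graphMap ((p z).2 k) ∘ₗ (θ k).toLinearMap) x := fun k =>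
    ((hh k).graphMap (c k)).comp_linear (RegularMapAt.const _ x)
  refine RegularMapAt.prodMk (RegularMapAt.pi S (fun k hk => ?_) fun k _ => hα k)
    (RegularMapAt.pi S (fun k hk => ?_) fun k _ => hβ k)
  · have := hw k hk
    infer_instance
  · have := ht k hk
    infer_instance

/-- The quotient of the stable locus is the variety of pairs `(f, U)`. The stable locus is given
in any vector space `R` identified with `IntRep w t`. -/
theorem exists_flagIso {R : Type u'} [AddCommGroup R] [Module ℂ R] (ρ : R ≃ₗ[ℂ] IntRep w t)
    (St : Set R) (hSt : ∀ x, x ∈ St ↔ ρ x ∈ intStable w t) (s : Setoid St)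
    (hs : ∀ x y : St, s x y ↔ ∃ g : ∀ k, t k ≃ₗ[ℂ] t k, ρ x = intAct g (ρ y)) :
    ∃ Φ : Iso (final (ι := Unit) (fun _ => subspace (affineSpace R) St) (Y := Quotient s)
        fun _ x => Quotient.mk s x)
        (flaggedComplexes w fun k => Module.finrank ℂ (t k)),
      ∀ x : St, Φ.toEquiv (Quotient.mk s x) = flagMap (ρ x) ((hSt x).1 x.2) := by
  let X := subspace (affineSpace R) St
  let Y := flaggedComplexes w fun k => Module.finrank ℂ (t k)
  let φ : X → Y := fun x => flagMap (ρ x.1) ((hSt x.1).1 x.2)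
  let Φ₀ : Quotient s → Y := Quotient.lift φ fun x y hxy => by
    obtain ⟨g, hg⟩ := (hs x y).1 hxy
    exact flagMap_intAct hg
  -- near any point the inverse of `Φ₀` lifts to the stable locus
  have hlocal : ∀ p : Y, ∃ σ : Y → X, IsMorphismAt Y X σ p ∧ ∀ᶠ z in 𝓝 p, φ (σ z) = z := by
    intro p
    choose c hc using fun k => exists_grChart (p.1.2 k)
    let θ (k : ℤ) : t k ≃ₗ[ℂ] (c k).A := LinearEquiv.ofFinrankEq _ _ (c k).finrank_eq.symm
    have hp : p.1 ∈ Set.range (homGrChart c) := ⟨(p.1.1, 0), Prod.ext rfl (funext hc)⟩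
    let G (z : Y) : IntRep w t := localSection c θ (chartCoordinate c z.1)
    have hGmem : ∀ z : Y, z.1 ∈ Set.range (homGrChart c) → ρ.symm (G z) ∈ St := by
      intro z hz
      rw [hSt, LinearEquiv.apply_symm_apply]
      exact localSection_mem c θ (homGrChart_chartCoordinate hz)
    classical
    let σ (z : Y) : X := if h : z.1 ∈ Set.range (homGrChart c) then ⟨ρ.symm (G z), hGmem z h⟩
      else ⟨ρ.symm (G p), hGmem p hp⟩
    have hσ : ∀ z : Y, z.1 ∈ Set.range (homGrChart c) → (σ z).1 = ρ.symm (G z) := by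
      intro z hz
      exact congrArg Subtype.val (dif_pos hz)
    have hnear : ∀ᶠ z : Y in 𝓝 p, z.1 ∈ Set.range (homGrChart c) := by
      have h1 := (isOpen_range_homGrChart S hw (c := c)).mem_nhds hp
      exact (isMorphismAt_val _ p).1.eventually h1
    refine ⟨σ, ?_, ?_⟩
    · refine IsMorphismAt.codRestrict (IsMorphismAt.congr (F := fun z => ρ.symm (G z)) ?_ ?_)
      · have h2 : RegularMapAt Y (fun z => chartCoordinate c z.1) p :=
          (regularMapAt_chartCoordinate S hw c p.1 hp).pullback (isMorphismAt_val _ p)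
        have h3 : RegularMapAt Y G p := regularMapAt_localSection S hw ht c θ h2
        exact (h3.linear ρ.symm.toLinearMap).isMorphismAt
      · filter_upwards [hnear] with z hz
        exact (hσ z hz).symm
    · filter_upwards [hnear] with z hz
      have h4 : ρ (σ z).1 = G z := by rw [hσ z hz, LinearEquiv.apply_symm_apply]
      have h5 := flagMap_localSection c θ (homGrChart_chartCoordinate hz)
      refine Eq.trans ?_ h5
      exact flagMap_congr _ _ h4
  have hinj : Function.Injective Φ₀ := by
    intro a b
    induction a using Quotient.inductionOn with | h x => ?_
    induction b using Quotient.inductionOn with | h y => ?_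
    intro h
    exact Quotient.sound ((hs x y).2 (exists_intAct_of_flagMap_eq h))
  have hsurj : Function.Surjective Φ₀ := by
    intro p
    obtain ⟨σ, -, hσ⟩ := hlocal p
    exact ⟨Quotient.mk s (σ p), hσ.self_of_nhds⟩
  let e : Quotient s ≃ Y := Equiv.ofBijective Φ₀ ⟨hinj, hsurj⟩
  refine ⟨⟨e, ?_, ?_⟩, fun x => rfl⟩
  · refine isMorphism_of_final _ _ _ fun _ x => ?_
    have h0 : RegularMapAt (affineSpace R) (fun z => ρ z) x.1 :=
      (regularMapAt_id x.1).linear ρ.toLinearMap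
    have h1 : RegularMapAt X (fun z => ρ z.1) x :=
      h0.pullback (isMorphismAt_val (Y := affineSpace R) St x)
    exact isMorphismAt_flagMap S hw (fun z : X => ρ z.1) (fun z => (hSt z.1).1 z.2) x
      (fun k => h1.linear (LinearMap.proj k ∘ₗ LinearMap.fst ℂ _ _))
      (fun k => h1.linear (LinearMap.proj k ∘ₗ LinearMap.snd ℂ _ _))
  · refine isMorphism_iff.2 fun p => ?_
    obtain ⟨σ, hσ, hφσ⟩ := hlocal p
    refine IsMorphismAt.congr (F := fun z => Quotient.mk s (σ z))
      ((isMorphismAt_final (fun _ : Unit => X) (fun _ x => Quotient.mk s x) () (σ p)).comp hσ) ?_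
    filter_upwards [hφσ] with z hz
    exact (e.symm_apply_eq.2 hz.symm).symm

end StableQuotient

/-! ### Reduction to integer indices -/

section Reindex

/-- The identification of two members of a family of vector spaces with equal indices. -/
def castEquiv (V : ℂˣ → Type u) [∀ b, AddCommGroup (V b)] [∀ b, Module ℂ (V b)] {b b' : ℂˣ}
    (h : b = b') : V b ≃ₗ[ℂ] V b' :=
  h ▸ LinearEquiv.refl ℂ (V b)

lemma exists_extension {ι κ : Type*} {i : ι → κ} (hi : Function.Injective i) {P : κ → Type*}
    [∀ b, Nonempty (P b)] (y : ∀ k, P (i k)) : ∃ x : ∀ b, P b, ∀ k, x (i k) = y k := by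
  classical
  have h1 : ∀ b, ∃ z : P b, ∀ k (h : i k = b), z = h ▸ y k := by
    intro b
    by_cases hb : ∃ k, i k = b
    · obtain ⟨k, rfl⟩ := hb
      refine ⟨y k, fun k' h => ?_⟩
      obtain rfl := hi h
      rfl
    · exact ⟨Classical.arbitrary _, fun k h => absurd ⟨k, h⟩ hb⟩
  choose x hx using h1
  exact ⟨x, fun k => hx _ k rfl⟩

/-- A product over `κ` whose factors outside the image of `i : ι → κ` vanish is a product over
`ι`. -/
def reindexEquiv {ι κ : Type*} {i : ι → κ} (hi : Function.Injective i) (P : κ → Type*)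
    [∀ b, AddCommGroup (P b)] [∀ b, Module ℂ (P b)]
    (hP : ∀ b, b ∉ Set.range i → Subsingleton (P b)) : (∀ b, P b) ≃ₗ[ℂ] ∀ k, P (i k) :=
  LinearEquiv.ofBijective (LinearMap.pi fun k => LinearMap.proj (i k)) <| by
    constructor
    · intro x y hxy
      funext b
      by_cases hb : b ∈ Set.range i
      · obtain ⟨k, rfl⟩ := hb
        exact congrFun hxy k
      · exact (hP b hb).elim _ _
    · intro y
      obtain ⟨x, hx⟩ := exists_extension hi y
      exact ⟨x, funext hx⟩

variable (q a : ℂˣ)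

lemma zpow_injective_of_not_root (hq : ∀ n : ℕ, 0 < n → q ^ n ≠ 1) :
    Function.Injective fun k : ℤ => q ^ k := by
  refine injective_zpow_iff_not_isOfFinOrder.2 fun h => ?_
  obtain ⟨n, hn, h1⟩ := isOfFinOrder_iff_pow_eq_one.1 h
  exact hq n hn h1

lemma injective_even (hq : ∀ n : ℕ, 0 < n → q ^ n ≠ 1) :
    Function.Injective fun k : ℤ => q ^ (2 * k) * a := by
  intro k k' h
  have := zpow_injective_of_not_root q hq (mul_right_cancel h)
  omega

lemma injective_odd (hq : ∀ n : ℕ, 0 < n → q ^ n ≠ 1) :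
    Function.Injective fun k : ℤ => q ^ (2 * k - 1) * a := by
  intro k k' h
  have := zpow_injective_of_not_root q hq (mul_right_cancel h)
  omega

lemma mul_even (k : ℤ) : q * (q ^ (2 * k) * a) = q ^ (2 * (k + 1) - 1) * a := by
  rw [← mul_assoc, ← zpow_one_add]
  congr 2
  ring

lemma mul_odd (k : ℤ) : q * (q ^ (2 * k - 1) * a) = q ^ (2 * k) * a := by
  rw [← mul_assoc, ← zpow_one_add]
  congr 2
  ring

variable {q a} in
lemma subsingleton_even {V : ℂˣ → Type u} {W : ℂˣ → Type v}
    (hsupp : ∀ b : ℂˣ, (∀ k : ℤ, b ≠ q ^ (2 * k) * a) → Subsingleton (V (q * b)) ∧ Subsingleton (W b))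
    (b : ℂˣ) (hb : b ∉ Set.range fun k : ℤ => q ^ (2 * k) * a) :
    Subsingleton (W b) :=
  (hsupp b fun k h => hb ⟨k, h.symm⟩).2

variable {q a} in
lemma subsingleton_odd {V : ℂˣ → Type u} {W : ℂˣ → Type v}
    (hsupp : ∀ b : ℂˣ, (∀ k : ℤ, b ≠ q ^ (2 * k) * a) → Subsingleton (V (q * b)) ∧ Subsingleton (W b))
    (b : ℂˣ) (hb : b ∉ Set.range fun k : ℤ => q ^ (2 * k - 1) * a) :
    Subsingleton (V b) := by
  have h1 := (hsupp (q⁻¹ * b) fun k h => hb ⟨k + 1, ?_⟩).1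
  · rwa [mul_inv_cancel_left] at h1
  · change q ^ (2 * (k + 1) - 1) * a = b
    rw [← mul_even, ← h, mul_inv_cancel_left]

variable (V : ℂˣ → Type u) (W : ℂˣ → Type v)
  [∀ b, AddCommGroup (V b)] [∀ b, Module ℂ (V b)]
  [∀ b, AddCommGroup (W b)] [∀ b, Module ℂ (W b)]

/-- The restriction of a point of `RepSpace` to the indices at which the spaces may be nonzero. -/
abbrev IndexedRep : Type (max u v) :=
  IntRep (fun k : ℤ => W (q ^ (2 * k) * a)) (fun k : ℤ => V (q ^ (2 * k - 1) * a))

variable {q a V W} (hq : ∀ n : ℕ, 0 < n → q ^ n ≠ 1)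
  (hsupp : ∀ b : ℂˣ, (∀ k : ℤ, b ≠ q ^ (2 * k) * a) → Subsingleton (V (q * b)) ∧ Subsingleton (W b))

/-- The identification of `RepSpace` with the model indexed by the integers. -/
def repEquiv : RepSpace q V W ≃ₗ[ℂ] IndexedRep q a V W :=
  LinearEquiv.prodCongr
    ((reindexEquiv (injective_even q a hq) (fun b => W b →ₗ[ℂ] V (q * b)) fun b hb => by
      have := subsingleton_even hsupp b hb
      infer_instance).trans
      (LinearEquiv.piCongrRight fun k =>
        LinearEquiv.congrRight (castEquiv V (mul_even q a k))))
    ((reindexEquiv (injective_odd q a hq) (fun b => V b →ₗ[ℂ] W (q * b)) fun b hb => by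
      have := subsingleton_odd hsupp b hb
      infer_instance).trans
      (LinearEquiv.piCongrRight fun k =>
        LinearEquiv.congrRight (castEquiv W (mul_odd q a k))))

lemma repEquiv_fst (x : RepSpace q V W) (k : ℤ) (y : W (q ^ (2 * k) * a)) :
    (repEquiv hq hsupp x).1 k y = castEquiv V (mul_even q a k) (x.α _ y) := rfl

lemma repEquiv_snd (x : RepSpace q V W) (k : ℤ) (y : V (q ^ (2 * k - 1) * a)) :
    (repEquiv hq hsupp x).2 k y = castEquiv W (mul_odd q a k) (x.β _ y) := rfl

lemma α_castEquiv (x : RepSpace q V W) {b b' : ℂˣ} (h : b = b') (y : W b) :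
    x.α b' (castEquiv W h y) = castEquiv V (congrArg (q * ·) h) (x.α b y) := by
  subst h
  rfl

lemma gauge_castEquiv (g : GaugeGroup V) {b b' : ℂˣ} (h : b = b') (y : V b) :
    g b' (castEquiv V h y) = castEquiv V h (g b y) := by
  subst h
  rfl

lemma repEquiv_mem_intZeroFibre (x : RepSpace q V W) :
    repEquiv hq hsupp x ∈ intZeroFibre (fun k : ℤ => W (q ^ (2 * k) * a))
      (fun k : ℤ => V (q ^ (2 * k - 1) * a)) ↔ x ∈ zeroFibre q V W := by
  have h1 : ∀ (k : ℤ) y, (repEquiv hq hsupp x).1 k ((repEquiv hq hsupp x).2 k y) =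
      castEquiv V (mul_even q a k) (castEquiv V (congrArg (q * ·) (mul_odd q a k))
        (x.α _ (x.β _ y))) := by
    intro k y
    rw [repEquiv_fst, repEquiv_snd, α_castEquiv]
  constructor
  · intro hx b
    refine LinearMap.ext fun y => ?_
    by_cases hb : b ∈ Set.range fun k : ℤ => q ^ (2 * k - 1) * a
    · obtain ⟨k, rfl⟩ := hb
      have h2 : (repEquiv hq hsupp x).1 k ((repEquiv hq hsupp x).2 k y) = 0 :=
        LinearMap.congr_fun (hx k) y
      rw [h1, LinearEquiv.map_eq_zero_iff, LinearEquiv.map_eq_zero_iff] at h2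
      exact h2
    · have := subsingleton_odd hsupp b hb
      rw [Subsingleton.elim y 0, map_zero, map_zero]
  · intro hx k
    refine LinearMap.ext fun y => ?_
    have h2 : x.α _ (x.β _ y) = 0 := LinearMap.congr_fun (hx _) y
    change (repEquiv hq hsupp x).1 k ((repEquiv hq hsupp x).2 k y) = 0
    rw [h1, h2, map_zero, map_zero]

lemma repEquiv_mem_intStable (x : RepSpace q V W) :
    x ∈ stableLocus q V W ↔ repEquiv hq hsupp x ∈ intStable (fun k : ℤ => W (q ^ (2 * k) * a))
      (fun k : ℤ => V (q ^ (2 * k - 1) * a)) := by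
  refine and_congr (repEquiv_mem_intZeroFibre hq hsupp x).symm ⟨fun h k => ?_, fun h b => ?_⟩
  · exact (castEquiv W (mul_odd q a k)).injective.comp (h _)
  · by_cases hb : b ∈ Set.range fun k : ℤ => q ^ (2 * k - 1) * a
    · obtain ⟨k, rfl⟩ := hb
      exact Function.Injective.of_comp (f := castEquiv W (mul_odd q a k)) (h k)
    · have := subsingleton_odd hsupp b hb
      exact Function.injective_of_subsingleton _

lemma repEquiv_smul (g : GaugeGroup V) (x : RepSpace q V W) :
    repEquiv hq hsupp (g • x) =
      intAct (fun k : ℤ => g (q ^ (2 * k - 1) * a)) (repEquiv hq hsupp x) := by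
  refine Prod.ext (funext fun k => LinearMap.ext fun y => ?_)
    (funext fun k => LinearMap.ext fun y => rfl)
  change castEquiv V (mul_even q a k) (g _ (x.α _ y)) =
    g _ (castEquiv V (mul_even q a k) (x.α _ y))
  rw [gauge_castEquiv]

include hq in
lemma exists_gauge (g : ∀ k : ℤ, V (q ^ (2 * k - 1) * a) ≃ₗ[ℂ] V (q ^ (2 * k - 1) * a)) :
    ∃ g' : GaugeGroup V, g = fun k : ℤ => g' (q ^ (2 * k - 1) * a) := by
  obtain ⟨g', h⟩ := exists_extension (injective_odd q a hq) (P := fun b => V b ≃ₗ[ℂ] V b) g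
  exact ⟨g', funext fun k => (h k).symm⟩

lemma stableSetoid_iff (x y : stableLocus q V W) :
    stableSetoid q V W x y ↔ ∃ g : ∀ k : ℤ, V (q ^ (2 * k - 1) * a) ≃ₗ[ℂ] V (q ^ (2 * k - 1) * a),
      repEquiv hq hsupp x.1 = intAct g (repEquiv hq hsupp y.1) := by
  constructor
  · rintro ⟨g, hg⟩
    have hg' : g • y.1 = x.1 := hg
    exact ⟨_, hg' ▸ repEquiv_smul hq hsupp g y.1⟩
  · rintro ⟨g, hg⟩
    obtain ⟨g', rfl⟩ := exists_gauge hq g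
    refine ⟨g', (repEquiv hq hsupp).injective ?_⟩
    exact (repEquiv_smul hq hsupp g' y.1).trans hg.symm

end Reindex

section Finiteness

variable {ι : Type*} (V : ι → Type u) [∀ b, AddCommGroup (V b)] [∀ b, Module ℂ (V b)]

lemma finiteDimensional_of_directSum (hV : FiniteDimensional ℂ (⨁ b, V b)) (b : ι) :
    FiniteDimensional ℂ (V b) := by
  classical
  exact Module.Finite.of_surjective (DirectSum.component ℂ ι V b) fun y =>
    ⟨DirectSum.lof ℂ ι V b y, DirectSum.component.lof_self ℂ _ _⟩

lemma exists_finset_support (hV : FiniteDimensional ℂ (⨁ b, V b)) :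
    ∃ S : Finset ι, ∀ b ∉ S, Subsingleton (V b) := by
  classical
  obtain ⟨s, hs⟩ := hV.fg_top
  refine ⟨s.biUnion fun x => DFinsupp.support x, fun b hb => ?_⟩
  have h1 : (⊤ : Submodule ℂ (⨁ b, V b)) ≤ LinearMap.ker (DirectSum.component ℂ ι V b) := by
    rw [← hs, Submodule.span_le]
    intro x hx
    by_contra h
    exact hb (Finset.mem_biUnion.2 ⟨x, hx, DFinsupp.mem_support_iff.2 h⟩)
  refine subsingleton_of_forall_eq 0 fun y => ?_
  have h2 := h1 (Submodule.mem_top (x := DirectSum.lof ℂ ι V b y))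
  rwa [LinearMap.mem_ker, DirectSum.component.lof_self] at h2

lemma exists_finset_support_comp (hV : FiniteDimensional ℂ (⨁ b, V b)) {κ : Type*} {i : κ → ι}
    (hi : Function.Injective i) : ∃ S : Finset κ, ∀ k ∉ S, Subsingleton (V (i k)) := by
  classical
  obtain ⟨S, hS⟩ := exists_finset_support V hV
  refine ⟨S.preimage i hi.injOn, fun k hk => hS _ fun h => hk (Finset.mem_preimage.2 h)⟩

lemma finiteDimensional_pi_of_support {ι : Type*} (E : ι → Type*) [∀ k, AddCommGroup (E k)]
    [∀ k, Module ℂ (E k)] [∀ k, FiniteDimensional ℂ (E k)] (S : Finset ι)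
    (hS : ∀ k ∉ S, Subsingleton (E k)) : FiniteDimensional ℂ (∀ k, E k) := by
  refine FiniteDimensional.of_injective
    (LinearMap.pi fun k : S => LinearMap.proj (R := ℂ) (φ := E) k.1) fun x y h => ?_
  funext k
  by_cases hk : k ∈ S
  · exact congrFun h ⟨k, hk⟩
  · exact (hS k hk).elim _ _

end Finiteness

/-! ### The invariant ring -/

section InvariantRing

lemma polyFun_comp_linear {E F : Type*} [AddCommGroup E] [Module ℂ E] [AddCommGroup F]
    [Module ℂ F] (L : E →ₗ[ℂ] F) {P : F → ℂ} (hP : P ∈ polyFun F) :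
    (fun x => P (L x)) ∈ polyFun E := by
  induction hP using Algebra.adjoin_induction with
  | mem P hP =>
    obtain ⟨l, rfl⟩ := hP
    exact dual_mem_polyFun (l ∘ₗ L)
  | algebraMap c => exact Subalgebra.algebraMap_mem _ c
  | add P Q _ _ h h' => exact Subalgebra.add_mem _ h h'
  | mul P Q _ _ h h' => exact Subalgebra.mul_mem _ h h'

variable {w : ℤ → Type v} {t : ℤ → Type u} [∀ k, AddCommGroup (w k)] [∀ k, Module ℂ (w k)]
  [∀ k, AddCommGroup (t k)] [∀ k, Module ℂ (t k)]
  [∀ k, FiniteDimensional ℂ (w k)] [∀ k, FiniteDimensional ℂ (t k)]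

lemma polyFun_comp_composite (S : Finset ℤ) (hw : ∀ k ∉ S, Subsingleton (w k))
    {Q : HomTuple w → ℂ} (hQ : Q ∈ polyFun (HomTuple w)) :
    (fun x : IntRep w t => Q (composite x)) ∈ polyFun (IntRep w t) := by
  induction hQ using Algebra.adjoin_induction with
  | mem Q hQ =>
    obtain ⟨l, rfl⟩ := hQ
    let e (k : ℤ) := Module.finBasis ℂ (w k →ₗ[ℂ] t (k + 1))
    have hS : ∀ k ∉ S, Subsingleton (w k →ₗ[ℂ] w (k + 1)) := fun k hk => by
      have := hw k hk
      infer_instance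
    have h1 : (fun x : IntRep w t => l (composite x)) = ∑ k ∈ S, ∑ i,
        (fun x : IntRep w t => ((e k).coord i ∘ₗ LinearMap.proj k ∘ₗ LinearMap.fst ℂ _ _) x) *
          fun x : IntRep w t => (l ∘ₗ LinearMap.single ℂ _ k ∘ₗ
            LinearMap.lcomp ℂ (w (k + 1)) (e k i) ∘ₗ LinearMap.proj (k + 1) ∘ₗ
              LinearMap.snd ℂ _ _) x := by
      funext x
      conv_lhs => rw [← sum_single_eq S hS (composite x), map_sum]
      rw [Finset.sum_apply]
      refine Finset.sum_congr rfl fun k _ => ?_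
      have h2 : composite x k = ∑ i, (e k).repr (x.1 k) i • (x.2 (k + 1) ∘ₗ e k i) := by
        conv_lhs => rw [composite, ← (e k).sum_repr (x.1 k)]
        ext y
        simp only [LinearMap.comp_apply, LinearMap.sum_apply, LinearMap.smul_apply, map_sum,
          map_smul]
      rw [h2, map_sum, map_sum, Finset.sum_apply]
      refine Finset.sum_congr rfl fun i _ => ?_
      rw [map_smul, map_smul]
      rfl
    rw [h1]
    exact Subalgebra.sum_mem _ fun k _ => Subalgebra.sum_mem _ fun i _ =>
      Subalgebra.mul_mem _ (dual_mem_polyFun _) (dual_mem_polyFun _)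
  | algebraMap c => exact Subalgebra.algebraMap_mem _ c
  | add P Q _ _ h h' => exact Subalgebra.add_mem _ h h'
  | mul P Q _ _ h h' => exact Subalgebra.mul_mem _ h h'

end InvariantRing

section Main

variable {q a : ℂˣ} {V : ℂˣ → Type u} {W : ℂˣ → Type v}
  [∀ b, AddCommGroup (V b)] [∀ b, Module ℂ (V b)]
  [∀ b, AddCommGroup (W b)] [∀ b, Module ℂ (W b)]
  [∀ b, FiniteDimensional ℂ (V b)] [∀ b, FiniteDimensional ℂ (W b)]
  (hq : ∀ n : ℕ, 0 < n → q ^ n ≠ 1)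
  (hsupp : ∀ b : ℂˣ, (∀ k : ℤ, b ≠ q ^ (2 * k) * a) → Subsingleton (V (q * b)) ∧ Subsingleton (W b))

/-- The invariant ring consists of the polynomials in the maps `β (k + 1) ∘ α k`. -/
lemma mem_invariantRing_iff (S : Finset ℤ)
    (hw : ∀ k ∉ S, Subsingleton (W (q ^ (2 * k) * a)))
    (ht : ∀ k ∉ S, Subsingleton (V (q ^ (2 * k - 1) * a))) (F : zeroFibre q V W → ℂ) :
    F ∈ invariantRing q V W ↔
      ∃ Q ∈ polyFun (HomTuple fun k : ℤ => W (q ^ (2 * k) * a)),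
        ∀ z, F z = Q (composite (repEquiv hq hsupp z.1)) := by
  let ρ := repEquiv hq hsupp
  constructor
  · rintro ⟨⟨P, hP, hFP⟩, hinv⟩
    have hmem : ∀ x ∈ intZeroFibre (fun k : ℤ => W (q ^ (2 * k) * a))
        (fun k : ℤ => V (q ^ (2 * k - 1) * a)), ρ.symm x ∈ zeroFibre q V W := fun x hx => by
      rw [← repEquiv_mem_intZeroFibre hq hsupp]
      rwa [show repEquiv hq hsupp (ρ.symm x) = x from ρ.apply_symm_apply x]
    obtain ⟨Q, hQ, hFQ⟩ := invariant_eq_polynomial_composite S hw ht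
      (fun x => F ⟨ρ.symm x.1, hmem x.1 x.2⟩)
      ⟨_, polyFun_comp_linear ρ.symm.toLinearMap hP, fun x => hFP _⟩ (fun g x y hxy => by
        obtain ⟨g', rfl⟩ := exists_gauge hq g
        refine hinv g' _ _ (ρ.injective ?_)
        change ρ (ρ.symm y.1) = ρ (g' • ρ.symm x.1)
        rw [ρ.apply_symm_apply, hxy]
        refine ((repEquiv_smul hq hsupp g' (ρ.symm x.1)).trans ?_).symm
        rw [show repEquiv hq hsupp (ρ.symm x.1) = x.1 from ρ.apply_symm_apply x.1])
    refine ⟨Q, hQ, fun z => ?_⟩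
    have := hFQ ⟨ρ z.1, (repEquiv_mem_intZeroFibre hq hsupp z.1).2 z.2⟩
    simp only [LinearEquiv.symm_apply_apply] at this
    exact this
  · rintro ⟨Q, hQ, hFQ⟩
    refine ⟨⟨_, polyFun_comp_linear ρ.toLinearMap (polyFun_comp_composite S hw hQ), hFQ⟩, ?_⟩
    intro g x y hxy
    rw [hFQ, hFQ, hxy, repEquiv_smul, composite_intAct]

end Main

end RankOneQuiver

end

theorem theorem3p1 (q a : ℂˣ) (hq : ∀ n : ℕ, 0 < n → q ^ n ≠ 1)
    (V : ℂˣ → Type*) (W : ℂˣ → Type*)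
    [∀ b, AddCommGroup (V b)] [∀ b, Module ℂ (V b)]
    [∀ b, AddCommGroup (W b)] [∀ b, Module ℂ (W b)]
    (hV : FiniteDimensional ℂ (⨁ b, V b)) (hW : FiniteDimensional ℂ (⨁ b, W b))
    (hsupp : ∀ b : ℂˣ, (∀ k : ℤ, b ≠ q ^ (2 * k) * a) →
      Subsingleton (V (q * b)) ∧ Subsingleton (W b)) :
    ∃ (Φ : RankOneQuiver.Iso (RankOneQuiver.quiverVariety q V W)
        (RankOneQuiver.flaggedComplexes (fun k : ℤ => W (q ^ (2 * k) * a))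
          (fun k : ℤ => Module.finrank ℂ (V (q ^ (2 * k - 1) * a)))))
      (Ψ : RankOneQuiver.Iso (RankOneQuiver.affineQuiverVariety q V W)
        (RankOneQuiver.boundedComplexes (fun k : ℤ => W (q ^ (2 * k) * a))
          (fun k : ℤ => Module.finrank ℂ (V (q ^ (2 * k + 1) * a))))),
      ∀ p : RankOneQuiver.quiverVariety q V W,
        RankOneQuiver.complexMaps (Ψ.toEquiv (RankOneQuiver.projMap q V W p)) =
          RankOneQuiver.forget (Φ.toEquiv p) := by
  classical
  have hfV := RankOneQuiver.finiteDimensional_of_directSum V hV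
  have hfW := RankOneQuiver.finiteDimensional_of_directSum W hW
  obtain ⟨S₁, hS₁⟩ := RankOneQuiver.exists_finset_support_comp W hW
    (RankOneQuiver.injective_even q a hq)
  obtain ⟨S₂, hS₂⟩ := RankOneQuiver.exists_finset_support_comp V hV
    (RankOneQuiver.injective_odd q a hq)
  have hw : ∀ k ∉ S₁ ∪ S₂, Subsingleton (W (q ^ (2 * k) * a)) := fun k hk =>
    hS₁ k fun h => hk (Finset.mem_union_left _ h)
  have ht : ∀ k ∉ S₁ ∪ S₂, Subsingleton (V (q ^ (2 * k - 1) * a)) := fun k hk =>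
    hS₂ k fun h => hk (Finset.mem_union_right _ h)
  obtain ⟨Φ, hΦ⟩ := RankOneQuiver.exists_flagIso (S₁ ∪ S₂) hw ht
    (RankOneQuiver.repEquiv hq hsupp) (RankOneQuiver.stableLocus q V W)
    (RankOneQuiver.repEquiv_mem_intStable hq hsupp) (RankOneQuiver.stableSetoid q V W)
    (RankOneQuiver.stableSetoid_iff hq hsupp)
  have hfin : FiniteDimensional ℂ
      (RankOneQuiver.HomTuple fun k : ℤ => W (q ^ (2 * k) * a)) :=
    RankOneQuiver.finiteDimensional_pi_of_support _ (S₁ ∪ S₂) fun k hk => by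
      have := hw k hk
      infer_instance
  have hr : ∀ k : ℤ, Module.finrank ℂ (V (q ^ (2 * k + 1) * a)) =
      Module.finrank ℂ (V (q ^ (2 * (k + 1) - 1) * a)) := fun k => by
    rw [show 2 * (k + 1) - 1 = 2 * k + 1 by ring]
  have hrange : Set.range (fun z : RankOneQuiver.zeroFibre q V W =>
      RankOneQuiver.composite (RankOneQuiver.repEquiv hq hsupp z.1)) =
      RankOneQuiver.complexSet (fun k : ℤ => W (q ^ (2 * k) * a))
        (fun k : ℤ => Module.finrank ℂ (V (q ^ (2 * k + 1) * a))) := by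
    rw [← RankOneQuiver.range_composite (t := fun k : ℤ => V (q ^ (2 * k - 1) * a)) _ hr]
    ext f
    constructor
    · rintro ⟨z, rfl⟩
      exact ⟨⟨_, (RankOneQuiver.repEquiv_mem_intZeroFibre hq hsupp z.1).2 z.2⟩, rfl⟩
    · rintro ⟨x, rfl⟩
      obtain ⟨z, hz⟩ := (RankOneQuiver.repEquiv hq hsupp).surjective x.1
      refine ⟨⟨z, (RankOneQuiver.repEquiv_mem_intZeroFibre hq hsupp z).1 (hz ▸ x.2)⟩, ?_⟩
      exact congrArg RankOneQuiver.composite hz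
  obtain ⟨Ψ, hΨ⟩ := RankOneQuiver.exists_specIso
    (fun z : RankOneQuiver.zeroFibre q V W =>
      RankOneQuiver.composite (RankOneQuiver.repEquiv hq hsupp z.1))
    (RankOneQuiver.invariantRing q V W)
    (RankOneQuiver.mem_invariantRing_iff hq hsupp (S₁ ∪ S₂) hw ht) _ hrange
    (RankOneQuiver.complexSet_closed _)
  refine ⟨Φ, Ψ, fun p => ?_⟩
  induction p using Quotient.inductionOn with | h x => ?_
  refine (hΨ ⟨x.1, x.2.1⟩).trans ?_
  exact congrArg RankOneQuiver.forget (hΦ x).symm
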